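/- Let $G$ be a finite simple planar graph, embedded in the plane so that every bounded face is a polygon, i.e. is bounded by a single closed walk (for connected $G$ this holds for every embedding), and let a root vertex $v_0$ on the boundary of the unbounded face $p_\infty$ be chosen. For a bounded face $p$ let $l(p)$ be the length of its boundary walk. A *corner* $(p,v)$ is an occurrence of the vertex $v$ on a boundary walk of the face $p$ (bounded or not), counted with multiplicity, so that a vertex $v$ has $\deg(v)$ corners. An *admissible state* $(a,b)$ consists of integers $a_p$ for the faces $p$ and $b_v$ for the vertices $v$, with $a_{p_\infty}=0$, $b_{v_0}=0$, and $a_p+b_v\ge 0$ whenever $v$ is a vertex of $p$ (in particular $b_v\ge0$ if $v$ lies on $p_\infty$, for instance if $v$ is isolated). Put $$A(a,b)=\sum_{p}\Bigl(l(p)a_p^2+2a_p\sum_{(p,v)}b_v\Bigr)+2\sum_{e=vw}b_vb_w,\qquad B(a,b)=2\sum_v b_v+\sum_p (l(p)-2)a_p,$$ where $p$ runs over the bounded faces, the inner sum over the corners of $p$, $e$ over the edges and $v$ over the vertices of $G$. Let $(q)_n=\prod_{i=1}^n(1-q^i)$ and $(q)_\infty=\prod_{i\ge1}(1-q^i)$,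 let $c_1$, $c_2$ and $c_3$ be the numbers of vertices, edges and 3-cycles of $G$, and let $$\Phi_G(q)=(q)_\infty^{c_2}\sum_{(a,b)}(-1)^{B(a,b)}\frac{q^{\frac12(A(a,b)+B(a,b))}}{\prod_{(p,v)}(q)_{a_p+b_v}},$$ the sum being over all admissible states and the product over all corners of all faces, including $p_\infty$. **Theorem.** For every admissible state $\frac12(A(a,b)+B(a,b))$ is a nonnegative integer, and the sum defining $\Phi_G(q)$ converges in $\mathbb Z[[q]]$ coefficientwise. Writing $\langle f\rangle_k$ for the coefficient of $q^k$ in $f\in\mathbb Z[[q]]$, one has $$\langle\Phi_G\rangle_0=1,\qquad \langle\Phi_G\rangle_1=c_1-c_2-1,\qquad \langle\Phi_G\rangle_2=\tfrac12\bigl((c_1-c_2)^2-2c_3-c_1+c_2\bigr).$$ -/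

import Mathlib

open scoped PowerSeries PowerSeries.WithPiTopology

/-! ### Rooted plane graphs

A plane embedding of a finite simple graph is given combinatorially, by a rotation system of
genus zero.  A dart is an oriented edge; the rotation sends a dart `d` to the next dart,
in the cyclic order of the plane, that starts at the same vertex. -/

/-- A rotation system on a simple graph: at each vertex, a cyclic order of the darts that
start there. -/
structure RotationSystem {V : Type*} (G : SimpleGraph V) where
  /-- the next dart around the initial vertex -/
  next : Equiv.Perm G.Dart
  next_fst : ∀ d : G.Dart, (next d).fst = d.fst
  sameCycle_of_fst_eq : ∀ d d' : G.Dart, d.fst = d'.fst → next.SameCycle d d'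

namespace RotationSystem

variable {V : Type*} {G : SimpleGraph V}

/-- One step along the boundary of a face: traverse the dart `d`, then leave its end point along
the dart that follows the reversal of `d`. -/
def facePerm (R : RotationSystem G) : Equiv.Perm G.Dart :=
  (SimpleGraph.Dart.symm_involutive (G := G)).toPerm.trans R.next

/-- The faces traced out by the rotation system: the orbits of `facePerm`, that is, the closed
boundary walks.  (An isolated vertex has no darts and contributes no orbit.) -/
def Face (R : RotationSystem G) : Type _ :=
  Quotient (Equiv.Perm.SameCycle.setoid R.facePerm)

/-- The face whose boundary walk runs through the dart `d`.  At the same time `d` stands for the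
corner of this face at the vertex `d.fst`, between `d` and the preceding dart of the walk. -/
def faceOf (R : RotationSystem G) (d : G.Dart) : R.Face :=
  Quotient.mk (Equiv.Perm.SameCycle.setoid R.facePerm) d

/-- The rotation system has genus zero on every connected component.  On each component
`V - E + F ≤ 2`, with equality exactly for the plane ones, where an isolated vertex has one face;
so it suffices to ask for equality of the sums over all components. -/
def IsPlanar (R : RotationSystem G) : Prop :=
  Nat.card V + (Nat.card R.Face + Nat.card {v : V // G.IsIsolated v}) =
    Nat.card G.edgeSet + 2 * Nat.card G.ConnectedComponent

end RotationSystem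

/-- A rooted plane graph with underlying simple graph `G`.  The embedding is such that every
bounded face is a polygon, i.e. is bounded by a single closed walk (for a connected graph all
faces of all embeddings are such).  Hence the components lie side by side in the plane, each in
the unbounded region of the others, and the boundary of the unbounded face consists of one face
walk for each component that has an edge, together with all the isolated vertices. -/
structure RootedPlaneGraph {V : Type*} (G : SimpleGraph V) extends RotationSystem G where
  planar : toRotationSystem.IsPlanar
  /-- the boundary walks of the unbounded face `p_∞` -/
  outer : Set toRotationSystem.Face
  /-- every component with an edge has exactly one boundary walk on the unbounded face -/
  outer_unique : ∀ v : V, ¬ G.IsIsolated v →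
    ∃! p : toRotationSystem.Face, p ∈ outer ∧
      ∃ d : G.Dart, toRotationSystem.faceOf d = p ∧ G.Reachable v d.fst
  /-- the root -/
  root : V
  /-- the root is a vertex of the unbounded face -/
  root_outer : G.IsIsolated root ∨
    ∃ d : G.Dart, d.fst = root ∧ toRotationSystem.faceOf d ∈ outer

/-! ### The `q`-series -/

/-- The finite product `(q)_n = (1 - q)(1 - q²)⋯(1 - qⁿ)` as a power series in `q = X`. -/
noncomputable def qFactorial (n : ℕ) : ℤ⟦X⟧ :=
  ∏ i ∈ Finset.range n, (1 - (PowerSeries.X : ℤ⟦X⟧) ^ (i + 1))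

/-- The infinite product `(q)_∞ = ∏_{n ≥ 1} (1 - qⁿ)`. -/
noncomputable def qFactorialInf : ℤ⟦X⟧ :=
  ∏' n : ℕ, (1 - (PowerSeries.X : ℤ⟦X⟧) ^ (n + 1))

/-- The series `1 / (q)_n`. -/
noncomputable def qFactorialInv (n : ℕ) : ℤ⟦X⟧ :=
  PowerSeries.invOfUnit (qFactorial n) 1

theorem constantCoeff_qFactorial (n : ℕ) : PowerSeries.constantCoeff (qFactorial n) = 1 := by
  simp [qFactorial, map_prod]

theorem qFactorial_mul_qFactorialInv (n : ℕ) : qFactorial n * qFactorialInv n = 1 :=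
  PowerSeries.mul_invOfUnit _ _ (by simp [constantCoeff_qFactorial])

theorem hasProd_qFactorialInf :
    HasProd (fun n : ℕ => 1 - (PowerSeries.X : ℤ⟦X⟧) ^ (n + 1)) qFactorialInf :=
  (PowerSeries.WithPiTopology.multipliable_one_sub_X_pow ℤ).hasProd

namespace RootedPlaneGraph

variable {V : Type*} [Fintype V] [DecidableEq V] {G : SimpleGraph V} [DecidableRel G.Adj]

noncomputable instance (R : RotationSystem G) : Fintype R.Face :=
  haveI : Finite R.Face := Quotient.finite _
  Fintype.ofFinite _

open Classical in
/-- The set of bounded faces. -/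
noncomputable def boundedFaces (M : RootedPlaneGraph G) : Finset M.Face :=
  Finset.univ.filter fun p => p ∉ M.outer

open Classical in
/-- The corners of the face `p`, each represented by a dart `d` on the boundary walk of `p`; the
corner sits at the vertex `d.fst`.  A vertex that is passed several times by the boundary walk
gives several corners. -/
noncomputable def corners (M : RootedPlaneGraph G) (p : M.Face) : Finset G.Dart :=
  Finset.univ.filter fun d => M.faceOf d = p

/-- The number `l(p)` of edges of the polygon `p`. -/
noncomputable def length (M : RootedPlaneGraph G) (p : M.Face) : ℕ := (M.corners p).card

/-- Admissible states: integers `a_p` for the faces and `b_v` for the vertices with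
`a_p + b_v ≥ 0` whenever `v` is a vertex of `p`, where `a_∞ = 0`, and with `b_v = 0` at the
root. -/
structure Admissible (M : RootedPlaneGraph G) (a : M.Face → ℤ) (b : V → ℤ) : Prop where
  outer_eq_zero : ∀ p ∈ M.outer, a p = 0
  corner_nonneg : ∀ d : G.Dart, 0 ≤ a (M.faceOf d) + b d.fst
  /-- an isolated vertex lies on the unbounded face -/
  isolated_nonneg : ∀ v : V, G.IsIsolated v → 0 ≤ b v
  root_eq_zero : b M.root = 0

/-- The type of admissible states `(a, b)`. -/
def State (M : RootedPlaneGraph G) : Type _ :=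
  {s : (M.Face → ℤ) × (V → ℤ) // M.Admissible s.1 s.2}

/-- `γ(p) = l(p) a_p² + 2 a_p (b_1 + ⋯ + b_{l(p)})`. -/
noncomputable def gamma (M : RootedPlaneGraph G) (a : M.Face → ℤ) (b : V → ℤ) (p : M.Face) : ℤ :=
  M.length p * a p ^ 2 + 2 * a p * ∑ d ∈ M.corners p, b d.fst

/-- `A(a, b)`: the sum of `γ(p)` over the bounded faces plus twice the sum of `b_v b_w` over the
edges `vw`. -/
noncomputable def A (M : RootedPlaneGraph G) (a : M.Face → ℤ) (b : V → ℤ) : ℤ :=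
  ∑ p ∈ M.boundedFaces, M.gamma a b p + 2 * ∑ e ∈ G.edgeFinset, (e.map b).mul

/-- `B(a, b) = 2 ∑_v b_v + ∑_p (l(p) - 2) a_p`, with `p` running over the bounded faces. -/
noncomputable def B (M : RootedPlaneGraph G) (a : M.Face → ℤ) (b : V → ℤ) : ℤ :=
  2 * ∑ v : V, b v + ∑ p ∈ M.boundedFaces, ((M.length p : ℤ) - 2) * a p

/-- The summand `(-1)^B q^{(A + B) / 2} / ∏ (q)_{a_p + b_v}` of a state; the product runs over
all corners of all faces, bounded or not.  Here `(A + B) / 2` is used as an exponent through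
`Int.toNat`. -/
noncomputable def term (M : RootedPlaneGraph G) (s : M.State) : ℤ⟦X⟧ :=
  PowerSeries.C ((Int.negOnePow (M.B s.1.1 s.1.2) : ℤˣ) : ℤ) *
    PowerSeries.X ^ ((M.A s.1.1 s.1.2 + M.B s.1.1 s.1.2) / 2).toNat *
    ∏ d : G.Dart, qFactorialInv (s.1.1 (M.faceOf d) + s.1.2 d.fst).toNat

/-- The series `Φ_G(q) = (q)_∞^{c₂} ∑_{(a,b)} (-1)^B q^{(A + B) / 2} / ∏ (q)_{a_p + b_v}`. The sum
is taken in `ℤ⟦q⟧` with the topology of coefficientwise (discrete) convergence. -/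
noncomputable def Phi (M : RootedPlaneGraph G) : ℤ⟦X⟧ :=
  qFactorialInf ^ G.edgeFinset.card * ∑' s : M.State, M.term s

end RootedPlaneGraph

set_option linter.unusedSectionVars false

/-! ### Darts and edges -/

/-! Only states with exponent at most 2 contribute to the three coefficients, so everything rests on
listing them. On admissible states A + B is the quadratic form `form`, the sum over darts of (a_p +
b_v)(a_p + b_w) + a_p plus linear terms. Corner values are nonnegative, so cross terms are
nonnegative and `form` is superadditive (`form_add_le`). Every nonzero state is a smaller admissible
state plus a layer (`Admissible.exists_layer`): either b = 1 on W and a = -1 on U, or b = -1 on W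
and a = 1 on U. Lower bounds on layers therefore bound a state by its exponent, which gives
nonnegativity, convergence and the list; parity is `even_form`.

On a layer the form counts vertices, faces and edges, and the bounds are Euler-type inequalities for
arbitrary W and U, proved by linear algebra over `ZMod 2`. Planarity enters through
`exists_filling`: every cycle modulo 2 is the boundary of a chain of bounded faces, and by
`eq_zero_of_faceBdry_eq_zero` of only one. A positive layer has form at least 6, unless W is
independent, U is empty and the form is 2|W| (`card_innerEdges_add_three_le`). A nonempty negative
layer has form at least 4, because the boundary of U is a nonzero cycle, and equality forces this
cycle to be a triangle (`card_inside_add_two_le`). Conversely every triangle bounds a set of faces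
that attains 4 (`exists_faces_of_clique`).

Hence exponent 0 is the zero state, exponent 1 a vertex other than the root, and exponent 2 a
nonadjacent, possibly equal pair of such vertices, or a triangle, with sign -1. At q² the factors
1/(q)_1 of the exponent 1 states add the degrees of all vertices but the root; the missing degree is
supplied by the count of pairs, so the root drops out. It remains to multiply by the c₂-th power of
(q)_∞ = 1 - q - q² + ⋯. -/

theorem ZMod.fun_add_self {ι : Type*} (f : ι → ZMod 2) : f + f = 0 :=
  funext fun i => CharTwo.add_self_eq_zero (f i)

theorem ZMod.eq_one_of_ne_zero_mod_two {a : ZMod 2} (h : a ≠ 0) : a = 1 :=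
  Fin.eq_one_of_ne_zero a h

namespace SimpleGraph

variable {V : Type*} {G : SimpleGraph V}

/-- The edge of a dart, as an element of the edge set. -/
def Dart.toEdge (d : G.Dart) : G.edgeSet := ⟨d.edge, d.edge_mem⟩

@[simp] theorem Dart.toEdge_symm (d : G.Dart) : d.symm.toEdge = d.toEdge :=
  Subtype.ext d.edge_symm

theorem Dart.toEdge_eq_iff {d d' : G.Dart} : d.toEdge = d'.toEdge ↔ d = d' ∨ d = d'.symm := by
  rw [← dart_edge_eq_iff]
  exact Subtype.ext_iff

theorem Dart.exists_toEdge_eq (e : G.edgeSet) : ∃ d : G.Dart, d.toEdge = e := by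
  obtain ⟨e, he⟩ := e
  induction e using Sym2.ind with
  | _ v w => exact ⟨⟨(v, w), he⟩, rfl⟩

/-- A chosen orientation of an edge. -/
noncomputable def edgeDart (e : G.edgeSet) : G.Dart := (Dart.exists_toEdge_eq e).choose

@[simp] theorem toEdge_edgeDart (e : G.edgeSet) : (edgeDart e).toEdge = e :=
  (Dart.exists_toEdge_eq e).choose_spec

variable [Fintype V] [DecidableEq V] [DecidableRel G.Adj]

theorem sum_dart_toEdge_eq {β : Type*} [AddCommMonoid β] (d₀ : G.Dart) (F : G.Dart → β) :
    (∑ d : G.Dart with d.toEdge = d₀.toEdge, F d) = F d₀ + F d₀.symm := by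
  have : (Finset.univ.filter fun d : G.Dart => d.toEdge = d₀.toEdge) = {d₀, d₀.symm} := by
    ext d
    simp [Dart.toEdge_eq_iff]
  rw [this, Finset.sum_pair d₀.symm_ne.symm]

theorem sum_dart_eq_sum_edge {β : Type*} [AddCommMonoid β] (F : G.Dart → β) :
    ∑ d : G.Dart, F d = ∑ e : G.edgeSet, (F (edgeDart e) + F (edgeDart e).symm) := by
  rw [← Finset.sum_fiberwise Finset.univ Dart.toEdge F]
  refine Finset.sum_congr rfl fun e _ => ?_
  conv_lhs => rw [← toEdge_edgeDart e]
  exact sum_dart_toEdge_eq _ _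

/-! ### Chains modulo 2 -/

/-- The boundary of a chain of edges modulo 2. -/
noncomputable def bdry : (G.edgeSet → ZMod 2) →ₗ[ZMod 2] (V → ZMod 2) where
  toFun z v := ∑ d : G.Dart with d.fst = v, z d.toEdge
  map_add' z z' := by ext v; simp [Finset.sum_add_distrib]
  map_smul' c z := by ext v; simp [Finset.mul_sum]

theorem bdry_apply (z : G.edgeSet → ZMod 2) (v : V) :
    bdry z v = ∑ d : G.Dart with d.fst = v, z d.toEdge := rfl

theorem bdry_single (d : G.Dart) :
    bdry (Pi.single d.toEdge 1) = Pi.single d.fst 1 + Pi.single d.snd (1 : ZMod 2) := by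
  ext v
  have := sum_dart_toEdge_eq d fun d' => if d'.fst = v then (1 : ZMod 2) else 0
  rw [bdry_apply, Finset.sum_filter]
  rw [Finset.sum_filter] at this
  simp only [Pi.add_apply, Pi.single_apply]
  simp only [eq_comm (a := v)]
  refine Eq.trans (Finset.sum_congr rfl fun d' _ => ?_) this
  split_ifs <;> rfl

theorem sum_bdry (z : G.edgeSet → ZMod 2) : ∑ v, bdry z v = 0 := by
  simp only [bdry_apply]
  rw [Finset.sum_fiberwise Finset.univ (fun d : G.Dart => d.fst) fun d => z d.toEdge,
    sum_dart_eq_sum_edge]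
  refine Finset.sum_eq_zero fun e _ => ?_
  simp [CharTwo.add_self_eq_zero]

/-- The edges of a walk from `v` to `w` add up to a chain whose boundary is the two end points; the
intermediate vertices cancel in pairs. -/
theorem single_add_single_mem_range_bdry {v w : V} (h : G.Reachable v w) :
    Pi.single v 1 + Pi.single w (1 : ZMod 2) ∈ LinearMap.range (bdry (G := G)) := by
  obtain ⟨p⟩ := h
  induction p with
  | nil => rw [ZMod.fun_add_self]; exact zero_mem _
  | @cons u v w h p ih =>
    have h1 : Pi.single u 1 + Pi.single v (1 : ZMod 2) ∈ LinearMap.range (bdry (G := G)) :=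
      ⟨_, bdry_single ⟨(u, v), h⟩⟩
    have := add_mem h1 ih
    rwa [add_add_add_comm, add_assoc, ← add_assoc (Pi.single v 1), ZMod.fun_add_self,
      zero_add] at this

/-- A vertex chain with zero sum on each component is a boundary, and these chains have codimension
at most the number of components. This half of the rank formula suffices for `exists_filling`. -/
theorem card_le_finrank_range_bdry :
    Fintype.card V ≤ Module.finrank (ZMod 2) (LinearMap.range (bdry (G := G))) +
      Nat.card G.ConnectedComponent := by
  classical
  let π : (V → ZMod 2) →ₗ[ZMod 2] (G.ConnectedComponent → ZMod 2) :=
    { toFun := fun f c => ∑ v with G.connectedComponentMk v = c, f v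
      map_add' := fun f g => by ext; simp [Finset.sum_add_distrib]
      map_smul' := fun f g => by ext; simp [Finset.mul_sum] }
  have hker : LinearMap.ker π ≤ LinearMap.range (bdry (G := G)) := by
    intro f hf
    let r : V → V := fun v => (G.connectedComponentMk v).out
    have hr : ∀ v, G.Reachable v (r v) := fun v =>
      (SimpleGraph.ConnectedComponent.exact (Quot.out_eq (G.connectedComponentMk v))).symm
    -- Moving the values of `f` to one representative per component leaves the component sums there,
    -- which vanish.
    have h0 : ∑ v, f v • (Pi.single (r v) 1 : V → ZMod 2) = 0 := by
      rw [← Finset.sum_fiberwise Finset.univ G.connectedComponentMk]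
      refine Finset.sum_eq_zero fun c _ => ?_
      have : ∀ v ∈ Finset.univ.filter (fun v => G.connectedComponentMk v = c),
          f v • (Pi.single (r v) 1 : V → ZMod 2) = f v • (Pi.single c.out 1 : V → ZMod 2) := by
        intro v hv
        rw [← (Finset.mem_filter.1 hv).2]
      rw [Finset.sum_congr rfl this, ← Finset.sum_smul]
      have h2 : π f c = 0 := by rw [LinearMap.mem_ker.1 hf]; rfl
      rw [show ∑ v with G.connectedComponentMk v = c, f v = 0 from h2, zero_smul]
    have h1 : f = ∑ v, f v • (Pi.single v 1 + Pi.single (r v) 1 : V → ZMod 2) := by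
      simp only [smul_add, Finset.sum_add_distrib, h0, add_zero]
      ext v
      simp [Finset.sum_apply, Pi.single_apply]
    rw [h1]
    exact sum_mem fun v _ => Submodule.smul_mem _ _ (single_add_single_mem_range_bdry (hr v))
  have h1 := Submodule.finrank_mono hker
  have h2 := π.finrank_range_add_finrank_ker
  have h3 := Submodule.finrank_le (LinearMap.range π)
  rw [Module.finrank_fintype_fun_eq_card] at h2 h3
  rw [Nat.card_eq_fintype_card]
  omega

end SimpleGraph

/-! ### Faces -/

namespace RotationSystem

open SimpleGraph

variable {V : Type*} {G : SimpleGraph V} (R : RotationSystem G)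

theorem facePerm_apply (d : G.Dart) : R.facePerm d = R.next d.symm := rfl

theorem facePerm_fst (d : G.Dart) : (R.facePerm d).fst = d.snd := R.next_fst d.symm

@[simp] theorem faceOf_facePerm (d : G.Dart) : R.faceOf (R.facePerm d) = R.faceOf d :=
  Quotient.sound (Equiv.Perm.SameCycle.symm (Equiv.Perm.sameCycle_apply_right.2 .rfl))

theorem faceOf_next (d : G.Dart) : R.faceOf (R.next d) = R.faceOf d.symm := by
  rw [← R.faceOf_facePerm d.symm, facePerm_apply, Dart.symm_symm]

theorem exists_faceOf_eq (p : R.Face) : ∃ d, R.faceOf d = p := Quotient.exists_rep p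

/-- A property of darts that is invariant under rotation is a property of the initial vertex. -/
theorem rotation_induction {P : G.Dart → Prop} (hnext : ∀ d, P d → P (R.next d))
    [Finite G.Dart] {d d' : G.Dart} (h : d.fst = d'.fst) (hd : P d) : P d' := by
  obtain ⟨n, rfl⟩ := (R.sameCycle_of_fst_eq d d' h).exists_nat_pow_eq
  clear h
  induction n with
  | zero => exact hd
  | succ n ih => rw [pow_succ', Equiv.Perm.mul_apply]; exact hnext _ ih

/-- A property of darts that is invariant under rotation and under reversal holds on the whole
connected component. -/
theorem dart_induction {P : G.Dart → Prop} (hnext : ∀ d, P d → P (R.next d))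
    (hsymm : ∀ d, P d → P d.symm) [Finite G.Dart] {d d' : G.Dart}
    (hr : G.Reachable d.fst d'.fst) (hd : P d) : P d' := by
  obtain ⟨w⟩ := hr
  generalize hu : d.fst = u at w
  generalize hv : d'.fst = v at w
  induction w generalizing d with
  | nil => exact R.rotation_induction hnext (hu.trans hv.symm) hd
  | @cons u v w h p ih =>
    have h1 : P ⟨(u, v), h⟩ := R.rotation_induction hnext hu hd
    exact ih (hsymm _ h1) rfl hv

/-- The coboundary of a chain of faces modulo 2: the edges with exactly one side in the chain,
i.e. the boundary of the chain. -/
noncomputable def faceBdry : (R.Face → ZMod 2) →ₗ[ZMod 2] (G.edgeSet → ZMod 2) where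
  toFun c e := c (R.faceOf (edgeDart e)) + c (R.faceOf (edgeDart e).symm)
  map_add' c c' := by ext e; simp only [Pi.add_apply]; ring
  map_smul' t c := by ext e; simp [mul_add]

theorem faceBdry_toEdge (c : R.Face → ZMod 2) (d : G.Dart) :
    R.faceBdry c d.toEdge = c (R.faceOf d) + c (R.faceOf d.symm) := by
  have h : (edgeDart d.toEdge).toEdge = d.toEdge := toEdge_edgeDart _
  rcases Dart.toEdge_eq_iff.1 h with h | h
  · simp [faceBdry, h]
  · simp [faceBdry, h, add_comm]

variable [Fintype V] [DecidableEq V] [DecidableRel G.Adj]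

/-- The two sides of a dart `d` are the faces of `d` and of `next d`; since `next` permutes the
darts at a vertex, every corner there is counted twice. -/
theorem bdry_faceBdry (c : R.Face → ZMod 2) : bdry (R.faceBdry c) = 0 := by
  ext v
  simp only [bdry_apply, faceBdry_toEdge, ← R.faceOf_next, Finset.sum_add_distrib, Pi.zero_apply]
  have : ∑ d : G.Dart with d.fst = v, c (R.faceOf (R.next d)) =
      ∑ d : G.Dart with d.fst = v, c (R.faceOf d) := by
    rw [Finset.sum_filter, Finset.sum_filter]
    refine Eq.trans (Finset.sum_congr rfl fun d _ => ?_)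
      (R.next.sum_comp Finset.univ (fun d => if d.fst = v then c (R.faceOf d) else 0) (by simp))
    simp [R.next_fst]
  rw [this, CharTwo.add_self_eq_zero]

end RotationSystem

/-! ### Filling cycles by bounded faces -/

namespace RootedPlaneGraph

open SimpleGraph

variable {V : Type*} {G : SimpleGraph V} (M : RootedPlaneGraph G)

theorem exists_outer_dart {v : V} (hv : ¬ G.IsIsolated v) :
    ∃ d : G.Dart, M.faceOf d ∈ M.outer ∧ G.Reachable v d.fst := by
  obtain ⟨p, ⟨hp, d, rfl, hd⟩, -⟩ := M.outer_unique v hv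
  exact ⟨d, hp, hd⟩

theorem not_isIsolated_fst (d : G.Dart) : ¬ G.IsIsolated d.fst := fun h => h _ d.adj

/-- A rotation and reversal invariant set of darts that contains no dart of the unbounded face is
empty. -/
theorem not_of_not_outer [Finite G.Dart] {P : G.Dart → Prop} (hnext : ∀ d, P d → P (M.next d))
    (hsymm : ∀ d, P d → P d.symm) (hout : ∀ d, M.faceOf d ∈ M.outer → ¬ P d) (d : G.Dart) :
    ¬ P d := by
  intro hd
  obtain ⟨d', hd', hr⟩ := M.exists_outer_dart (not_isIsolated_fst d)
  exact hout d' hd' (M.dart_induction hnext hsymm hr hd)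

/-- With zero boundary, `c` agrees on the two sides of every edge, hence is constant along each
component, and each component with an edge has a walk on the unbounded face, where `c` vanishes. -/
theorem eq_zero_of_faceBdry_eq_zero [Finite G.Dart] {c : M.Face → ZMod 2}
    (hc : ∀ p ∈ M.outer, c p = 0) (h : M.faceBdry c = 0) : c = 0 := by
  have hs : ∀ d : G.Dart, c (M.faceOf d.symm) = c (M.faceOf d) := by
    intro d
    have := M.faceBdry_toEdge c d
    rw [h] at this
    exact (CharTwo.add_eq_zero.1 this.symm).symm
  ext p
  obtain ⟨d, rfl⟩ := M.exists_faceOf_eq p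
  by_contra hd
  refine M.not_of_not_outer (P := fun d => c (M.faceOf d) ≠ 0) (fun d hd => ?_) (fun d hd => ?_)
    (fun d hd h => h (hc _ hd)) d hd
  · rwa [M.faceOf_next, hs]
  · rwa [hs]

variable [Fintype V] [DecidableEq V] [DecidableRel G.Adj]

/-- Distinct outer walks and isolated vertices lie in distinct components. Through Euler's formula
this bounds the number of bounded faces from below. -/
theorem card_outer_add_card_isolated_le :
    Nat.card M.outer + Nat.card {v : V // G.IsIsolated v} ≤ Nat.card G.ConnectedComponent := by
  classical
  rw [← Nat.card_sum]
  let D : M.outer → G.Dart := fun p => (M.exists_faceOf_eq p.1).choose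
  have hD : ∀ p, M.faceOf (D p) = p.1 := fun p => (M.exists_faceOf_eq p.1).choose_spec
  refine Nat.card_le_card_of_injective
    (Sum.elim (fun p => G.connectedComponentMk (D p).fst) fun v => G.connectedComponentMk v.1) ?_
  have hiso : ∀ (v w : V), G.IsIsolated v → G.Reachable v w → v = w := by
    rintro v w hv ⟨p⟩
    cases p with
    | nil => rfl
    | cons h p => exact absurd h (hv _)
  rintro (p | v) (q | w) h
  · have hr := ConnectedComponent.exact h
    obtain ⟨r, -, hr'⟩ := M.outer_unique _ (not_isIsolated_fst (D p))
    have h1 := hr' p.1 ⟨p.2, D p, hD p, .rfl⟩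
    have h2 := hr' q.1 ⟨q.2, D q, hD q, hr⟩
    exact congrArg _ (Subtype.ext (h1.trans h2.symm))
  · have := hiso _ _ w.2 (ConnectedComponent.exact h).symm
    exact absurd (this ▸ w.2) (not_isIsolated_fst (D p))
  · have := hiso _ _ v.2 (ConnectedComponent.exact h)
    exact absurd (this ▸ v.2) (not_isIsolated_fst (D q))
  · exact congrArg _ (Subtype.ext (hiso _ _ v.2 (ConnectedComponent.exact h)))

/-- On a plane graph there is a linear way to fill in the cycles modulo 2 by bounded faces. -/
theorem exists_filling : ∃ L : (G.edgeSet → ZMod 2) →ₗ[ZMod 2] (M.Face → ZMod 2),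
    ∀ z, bdry z = 0 → (∀ p ∈ M.outer, L z p = 0) ∧ M.faceBdry (L z) = z := by
  classical
  let ext : ({p : M.Face // p ∉ M.outer} → ZMod 2) →ₗ[ZMod 2] (M.Face → ZMod 2) :=
    { toFun := fun c p => if h : p ∈ M.outer then 0 else c ⟨p, h⟩
      map_add' := fun c c' => by ext p; by_cases h : p ∈ M.outer <;> simp [h]
      map_smul' := fun t c => by ext p; by_cases h : p ∈ M.outer <;> simp [h] }
  have hext : ∀ c, ∀ p ∈ M.outer, ext c p = 0 := fun c p hp => by simp [ext, hp]
  let f := M.faceBdry ∘ₗ ext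
  have hker : LinearMap.ker f = ⊥ := by
    rw [LinearMap.ker_eq_bot']
    intro c hc
    have := M.eq_zero_of_faceBdry_eq_zero (hext c) hc
    ext p
    have h2 := congrFun this p.1
    simpa [ext, p.2] using h2
  obtain ⟨g, hg⟩ := f.exists_leftInverse_of_injective hker
  have hle : LinearMap.range f ≤ LinearMap.ker (bdry (G := G)) := by
    rintro _ ⟨c, rfl⟩
    exact M.bdry_faceBdry _
  -- Dimension count, with k the number of components: Euler's formula gives at least E - V + k
  -- bounded faces, while the cycle space has dimension at most E - V + k.
  have heq : LinearMap.range f = LinearMap.ker (bdry (G := G)) := by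
    refine Submodule.eq_of_le_of_finrank_le hle ?_
    have h1 := LinearMap.finrank_range_of_inj (LinearMap.ker_eq_bot.1 hker)
    have h2 := (bdry (G := G)).finrank_range_add_finrank_ker
    have h3 := card_le_finrank_range_bdry (G := G)
    have h4 := M.card_outer_add_card_isolated_le
    have h5 := M.planar
    rw [Module.finrank_fintype_fun_eq_card] at h1 h2
    have h6 : Nat.card M.outer + Nat.card {p : M.Face // p ∉ M.outer} = Nat.card M.Face := by
      rw [Nat.card_eq_fintype_card, Nat.card_eq_fintype_card, Nat.card_eq_fintype_card]
      have h7 := Fintype.card_subtype_le (fun p => p ∈ M.outer)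
      rw [Fintype.card_subtype_compl]
      change Fintype.card {p // p ∈ M.outer} + _ = _
      omega
    unfold RotationSystem.IsPlanar at h5
    rw [Nat.card_eq_fintype_card (α := V), Nat.card_eq_fintype_card (α := G.edgeSet)] at h5
    rw [Nat.card_eq_fintype_card (α := {p : M.Face // p ∉ M.outer})] at h6
    omega
  refine ⟨ext ∘ₗ g, fun z hz => ⟨fun p hp => hext _ p hp, ?_⟩⟩
  obtain ⟨c, rfl⟩ : z ∈ LinearMap.range f := heq ▸ hz
  have : g (f c) = c := LinearMap.congr_fun hg c
  simp only [LinearMap.comp_apply, this]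
  rfl

end RootedPlaneGraph

/-! ### Edge counts -/

section Extend

variable {α : Type*} [DecidableEq α]

/-- Extension by zero of a function on a finset. -/
def extendZero (S : Finset α) : (S → ZMod 2) →ₗ[ZMod 2] (α → ZMod 2) where
  toFun f a := if h : a ∈ S then f ⟨a, h⟩ else 0
  map_add' f g := by ext a; by_cases h : a ∈ S <;> simp [h]
  map_smul' t f := by ext a; by_cases h : a ∈ S <;> simp [h]

theorem extendZero_of_mem {S : Finset α} (f : S → ZMod 2) {a : α} (h : a ∈ S) :
    extendZero S f a = f ⟨a, h⟩ := dif_pos h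

theorem extendZero_of_notMem {S : Finset α} (f : S → ZMod 2) {a : α} (h : a ∉ S) :
    extendZero S f a = 0 := dif_neg h

theorem eq_zero_of_extendZero_eq_zero {S : Finset α} {f : S → ZMod 2}
    (h : extendZero S f = 0) : f = 0 := by
  ext ⟨a, ha⟩
  rw [← extendZero_of_mem f ha, h]
  rfl

end Extend

namespace RootedPlaneGraph

open SimpleGraph

variable {V : Type*} {G : SimpleGraph V} (M : RootedPlaneGraph G)

/-- Both sides of the edge `e` belong to `U`. -/
def BothSides (U : Finset M.Face) (e : G.edgeSet) : Prop :=
  M.faceOf (edgeDart e) ∈ U ∧ M.faceOf (edgeDart e).symm ∈ U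

/-- At least one side of the edge `e` belongs to `U`. -/
def SomeSide (U : Finset M.Face) (e : G.edgeSet) : Prop :=
  M.faceOf (edgeDart e) ∈ U ∨ M.faceOf (edgeDart e).symm ∈ U

/-- Both ends of the edge `e` belong to `W`. -/
def _root_.SimpleGraph.BothEnds (W : Finset V) (e : G.edgeSet) : Prop :=
  (edgeDart e).fst ∈ W ∧ (edgeDart e).snd ∈ W

/-- No end of the edge `e` belongs to `W`. -/
def _root_.SimpleGraph.NoEnd (W : Finset V) (e : G.edgeSet) : Prop :=
  (edgeDart e).fst ∉ W ∧ (edgeDart e).snd ∉ W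

theorem bothSides_toEdge (U : Finset M.Face) (d : G.Dart) :
    M.BothSides U d.toEdge ↔ M.faceOf d ∈ U ∧ M.faceOf d.symm ∈ U := by
  rcases Dart.toEdge_eq_iff.1 (toEdge_edgeDart d.toEdge) with h | h
  · simp [BothSides, h]
  · simp [BothSides, h, and_comm]

theorem someSide_toEdge (U : Finset M.Face) (d : G.Dart) :
    M.SomeSide U d.toEdge ↔ M.faceOf d ∈ U ∨ M.faceOf d.symm ∈ U := by
  rcases Dart.toEdge_eq_iff.1 (toEdge_edgeDart d.toEdge) with h | h
  · simp [SomeSide, h]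
  · simp [SomeSide, h, or_comm]

theorem _root_.SimpleGraph.bothEnds_toEdge (W : Finset V) (d : G.Dart) :
    BothEnds W d.toEdge ↔ d.fst ∈ W ∧ d.snd ∈ W := by
  rcases Dart.toEdge_eq_iff.1 (toEdge_edgeDart d.toEdge) with h | h
  · simp [BothEnds, h]
  · simp [BothEnds, h, and_comm]

theorem _root_.SimpleGraph.noEnd_toEdge (W : Finset V) (d : G.Dart) :
    NoEnd W d.toEdge ↔ d.fst ∉ W ∧ d.snd ∉ W := by
  rcases Dart.toEdge_eq_iff.1 (toEdge_edgeDart d.toEdge) with h | h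
  · simp [NoEnd, h]
  · simp [NoEnd, h, and_comm]

variable [Fintype V] [DecidableEq V] [DecidableRel G.Adj]

theorem _root_.SimpleGraph.bdry_eq_zero_of_noEnd {W : Finset V} {z : G.edgeSet → ZMod 2}
    (hz : ∀ e, z e ≠ 0 → NoEnd W e) {v : V} (hv : v ∈ W) : bdry z v = 0 := by
  rw [bdry_apply]
  refine Finset.sum_eq_zero fun d hd => ?_
  by_contra h
  have := (noEnd_toEdge W d).1 (hz _ h)
  rw [(Finset.mem_filter.1 hd).2] at this
  exact this.1 hv

theorem _root_.SimpleGraph.bdry_eq_zero_of_bothEnds {W : Finset V} {z : G.edgeSet → ZMod 2}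
    (hz : ∀ e, z e ≠ 0 → BothEnds W e) {v : V} (hv : v ∉ W) : bdry z v = 0 := by
  rw [bdry_apply]
  refine Finset.sum_eq_zero fun d hd => ?_
  by_contra h
  have := (bothEnds_toEdge W d).1 (hz _ h)
  rw [(Finset.mem_filter.1 hd).2] at this
  exact hv this.1

open scoped Classical in
/-- A set `D` of edges inside `W` such that every nonzero chain of bounded faces with boundary in
`D` meets `U` has fewer than `|W| + |U|` elements. -/
theorem card_add_one_le {W : Finset V} {U : Finset M.Face} {D : Finset G.edgeSet}
    (hW : W.Nonempty) (hD : ∀ e ∈ D, BothEnds W e)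
    (hacyc : ∀ c : M.Face → ZMod 2, (∀ p ∈ M.outer, c p = 0) → (∀ p ∈ U, c p = 0) →
      (∀ e, M.faceBdry c e ≠ 0 → e ∈ D) → c = 0) :
    D.card + 1 ≤ W.card + U.card := by
  obtain ⟨w₀, hw₀⟩ := hW
  obtain ⟨L, hL⟩ := M.exists_filling
  -- A chain on `D` is determined by its boundary on `W` without `w₀` together with its filling on
  -- `U`. The vertex `w₀` can be left out because the values of a boundary sum to zero.
  let Λ : (D → ZMod 2) →ₗ[ZMod 2] (↥(W.erase w₀) → ZMod 2) × (U → ZMod 2) :=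
    ((LinearMap.funLeft (ZMod 2) (ZMod 2) Subtype.val ∘ₗ bdry).prod
      (LinearMap.funLeft (ZMod 2) (ZMod 2) Subtype.val ∘ₗ L)) ∘ₗ extendZero D
  have hinj : Function.Injective Λ := by
    rw [injective_iff_map_eq_zero]
    intro f hf
    have hsupp : ∀ e, extendZero D f e ≠ 0 → e ∈ D := fun e he => by
      by_contra h
      exact he (extendZero_of_notMem f h)
    set z := extendZero D f with hz
    have h1 : ∀ v ∈ W.erase w₀, bdry z v = 0 := fun v hv =>
      congrFun (congrArg Prod.fst hf) ⟨v, hv⟩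
    have h2 : ∀ p ∈ U, L z p = 0 := fun p hp =>
      congrFun (congrArg Prod.snd hf) ⟨p, hp⟩
    have h3 : ∀ v, v ≠ w₀ → bdry z v = 0 := by
      intro v hv
      by_cases hvW : v ∈ W
      · exact h1 v (Finset.mem_erase.2 ⟨hv, hvW⟩)
      · exact bdry_eq_zero_of_bothEnds (fun e he => hD e (hsupp e he)) hvW
    have h4 : bdry z = 0 := by
      ext v
      by_cases hv : v = w₀
      · have := sum_bdry z
        rw [Finset.sum_eq_single w₀ (fun v _ hv => h3 v hv) (by simp)] at this
        rw [hv, this]; rfl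
      · exact h3 v hv
    have h5 := (hL z h4).2
    have h6 := hacyc (L z) (hL z h4).1 h2 (by rwa [h5])
    rw [h6, map_zero] at h5
    exact eq_zero_of_extendZero_eq_zero h5.symm
  have := LinearMap.finrank_le_finrank_of_injective hinj
  rw [Module.finrank_prod, Module.finrank_fintype_fun_eq_card, Module.finrank_fintype_fun_eq_card,
    Module.finrank_fintype_fun_eq_card, Fintype.card_coe, Fintype.card_coe, Fintype.card_coe,
    Finset.card_erase_of_mem hw₀] at this
  have := Finset.card_pos.2 ⟨w₀, hw₀⟩
  omega

/-- A chain of edges meeting `W` with prescribed boundary in `W`, if no component of the graph is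
contained in `W`. -/
theorem _root_.SimpleGraph.exists_chain_bdry_eq_single {W : Finset V} {v u : V} (hv : v ∈ W)
    (hu : u ∉ W) (h : G.Reachable v u) :
    ∃ z : G.edgeSet → ZMod 2, (∀ e, z e ≠ 0 → ¬ NoEnd W e) ∧
      ∀ w ∈ W, bdry z w = (Pi.single v 1 : V → ZMod 2) w := by
  obtain ⟨p⟩ := h
  induction p with
  | nil => exact absurd hv hu
  | @cons v x u h p ih =>
    let d : G.Dart := ⟨(v, x), h⟩
    have hd : ∀ e, (Pi.single d.toEdge 1 : G.edgeSet → ZMod 2) e ≠ 0 → ¬ NoEnd W e := by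
      intro e he
      have : e = d.toEdge := by
        by_contra hne
        exact he (Pi.single_eq_of_ne hne _)
      rw [this, noEnd_toEdge]
      exact fun h => h.1 hv
    -- The chain stops at the first vertex of the walk outside `W`, where its boundary is not
    -- prescribed.
    by_cases hx : x ∈ W
    · obtain ⟨z, hz, hz'⟩ := ih hx hu
      refine ⟨Pi.single d.toEdge 1 + z, fun e he => ?_, fun w hw => ?_⟩
      · by_cases h1 : z e = 0
        · exact hd e (by simpa [h1] using he)
        · exact hz e h1
      · rw [map_add, bdry_single, Pi.add_apply, hz' w hw, Pi.add_apply, add_assoc]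
        rw [CharTwo.add_self_eq_zero, add_zero]
    · refine ⟨Pi.single d.toEdge 1, hd, fun w hw => ?_⟩
      have : w ≠ x := fun h => hx (h ▸ hw)
      rw [bdry_single, Pi.add_apply, Pi.single_eq_of_ne (M := fun _ => ZMod 2) this, add_zero]

open scoped Classical in
/-- If all faces around `W` belong to the set `U` of bounded faces, and `D` is a forest of edges on
the boundary of `U`, not meeting `W`, then `U` has at least `|W| + |U| + |D|` edges. -/
theorem card_add_card_add_card_le {W : Finset V} {U : Finset M.Face} {D : Finset G.edgeSet}
    (hU : ∀ p ∈ M.outer, p ∉ U) (hW : ∀ v ∈ W, ¬ G.IsIsolated v)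
    (hWU : ∀ d : G.Dart, d.fst ∈ W → M.faceOf d ∈ U)
    (hD : ∀ e ∈ D, M.SomeSide U e ∧ NoEnd W e)
    (hacyc : ∀ z : G.edgeSet → ZMod 2, (∀ e, z e ≠ 0 → e ∈ D) → bdry z = 0 → z = 0) :
    W.card + U.card + D.card ≤ (Finset.univ.filter (M.SomeSide U)).card := by
  set EU := Finset.univ.filter (M.SomeSide U)
  have hsec : ∀ v : W, ∃ z : G.edgeSet → ZMod 2, (∀ e, z e ≠ 0 → ¬ NoEnd W e) ∧
      ∀ w ∈ W, bdry z w = (Pi.single v.1 1 : V → ZMod 2) w := by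
    intro v
    obtain ⟨d, hd, hr⟩ := M.exists_outer_dart (hW v v.2)
    exact exists_chain_bdry_eq_single v.2 (fun h => hU _ hd (hWU d h)) hr
  choose ζ hζ hζ' using hsec
  let s : (W → ZMod 2) →ₗ[ZMod 2] (G.edgeSet → ZMod 2) := Fintype.linearCombination (ZMod 2) ζ
  have hs : ∀ f (w : W), bdry (s f) w = f w := by
    intro f w
    simp only [s, Fintype.linearCombination_apply, map_sum, map_smul, Finset.sum_apply,
      Pi.smul_apply]
    rw [Finset.sum_eq_single w]
    · rw [hζ' w w w.2]; simp
    · intro v _ hv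
      rw [hζ' v w w.2, Pi.single_eq_of_ne (fun h => hv (Subtype.ext h.symm)), smul_zero]
    · simp
  -- The three kinds of chains are independent: on `W` the boundary of the sum is `f`, since face
  -- boundaries are cycles and `D` does not meet `W`. Then `z` is a cycle on a forest, and finally
  -- `c` has zero boundary.
  let Ψ : (W → ZMod 2) × (U → ZMod 2) × (D → ZMod 2) →ₗ[ZMod 2] (G.edgeSet → ZMod 2) :=
    s.coprod ((M.faceBdry ∘ₗ extendZero U).coprod (extendZero D))
  let Λ := LinearMap.funLeft (ZMod 2) (ZMod 2) (Subtype.val : EU → G.edgeSet) ∘ₗ Ψ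
  have hsome : ∀ e, ¬ NoEnd W e → M.SomeSide U e := by
    intro e he
    rw [NoEnd, not_and_or, not_not, not_not] at he
    rcases he with he | he
    · exact Or.inl (hWU _ he)
    · exact Or.inr (hWU _ he)
  have hΨ : ∀ x e, e ∉ EU → Ψ x e = 0 := by
    rintro ⟨f, c, z⟩ e he
    have he' : ¬ M.SomeSide U e := by simpa [EU] using he
    have h1 : s f e = 0 := by
      simp only [s, Fintype.linearCombination_apply, Finset.sum_apply, Pi.smul_apply]
      refine Finset.sum_eq_zero fun v _ => ?_
      by_contra hne
      exact he' (hsome e (hζ v e fun h => hne (by rw [h, smul_zero])))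
    have h2 : M.faceBdry (extendZero U c) e = 0 := by
      rw [SomeSide, not_or] at he'
      change extendZero U c _ + extendZero U c _ = 0
      rw [extendZero_of_notMem c he'.1, extendZero_of_notMem c he'.2, add_zero]
    have h3 : extendZero D z e = 0 := extendZero_of_notMem z fun h => he' (hD e h).1
    simp [Ψ, h1, h2, h3]
  have hinj : Function.Injective Λ := by
    rw [injective_iff_map_eq_zero]
    rintro ⟨f, c, z⟩ hx
    have h0 : Ψ (f, c, z) = 0 := by
      ext e
      by_cases he : e ∈ EU
      · exact congrFun hx ⟨e, he⟩
      · exact hΨ _ e he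
    have hΨe : Ψ (f, c, z) = s f + (M.faceBdry (extendZero U c) + extendZero D z) := rfl
    have hzD : ∀ e, extendZero D z e ≠ 0 → e ∈ D := fun e he => by
      by_contra h
      exact he (extendZero_of_notMem z h)
    have hf : f = 0 := by
      ext w
      have h1 := congrFun (congrArg bdry h0) w.1
      rw [hΨe, map_add, map_add, M.bdry_faceBdry, zero_add, Pi.add_apply, hs,
        bdry_eq_zero_of_noEnd (fun e he => (hD e (hzD e he)).2) w.2, map_zero, add_zero] at h1
      exact h1
    rw [hΨe, hf, map_zero, zero_add] at h0
    have hz0 : extendZero D z = 0 := by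
      refine hacyc _ hzD ?_
      have := congrArg bdry h0
      rwa [map_add, M.bdry_faceBdry, zero_add, map_zero] at this
    rw [hz0, add_zero] at h0
    have hc : extendZero U c = 0 := M.eq_zero_of_faceBdry_eq_zero
      (fun p hp => extendZero_of_notMem c (hU p hp)) h0
    rw [hf, eq_zero_of_extendZero_eq_zero hz0, eq_zero_of_extendZero_eq_zero hc]
    rfl
  have := LinearMap.finrank_le_finrank_of_injective hinj
  rw [Module.finrank_prod, Module.finrank_prod, Module.finrank_fintype_fun_eq_card,
    Module.finrank_fintype_fun_eq_card, Module.finrank_fintype_fun_eq_card,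
    Module.finrank_fintype_fun_eq_card, Fintype.card_coe, Fintype.card_coe, Fintype.card_coe,
    Fintype.card_coe] at this
  omega

end RootedPlaneGraph

/-! ### Short cycles -/

namespace SimpleGraph

variable {V : Type*} {G : SimpleGraph V} [Fintype V] [DecidableEq V] [DecidableRel G.Adj]

theorem exists_dart_ne_of_bdry_eq_zero {z : G.edgeSet → ZMod 2} (hz : bdry z = 0) {d : G.Dart}
    (hd : z d.toEdge ≠ 0) : ∃ d' : G.Dart, d' ≠ d ∧ d'.fst = d.fst ∧ z d'.toEdge ≠ 0 := by
  by_contra! h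
  have h1 := congrFun hz d.fst
  rw [bdry_apply, Finset.sum_eq_single d (fun d' hd' hne => h d' hne (Finset.mem_filter.1 hd').2)
    (by simp)] at h1
  exact hd h1

theorem Dart.toEdge_ne {d d' : G.Dart} (h : d'.fst ≠ d.fst ∨ d'.snd ≠ d.snd)
    (h' : d'.fst ≠ d.snd ∨ d'.snd ≠ d.fst) : d'.toEdge ≠ d.toEdge := by
  rw [Ne, Dart.toEdge_eq_iff, not_or]
  exact ⟨by rintro rfl; simp at h, by rintro rfl; simp at h'⟩

/-- A nonzero cycle continues beyond both ends of each of its edges; the two continuations could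
coincide only along an edge parallel to the first, which a simple graph does not have. -/
theorem exists_edges_of_bdry_eq_zero {z : G.edgeSet → ZMod 2} (hz : bdry z = 0) (h0 : z ≠ 0) :
    ∃ d₁ d₂ d₃ : G.Dart, d₂.fst = d₁.fst ∧ d₃.fst = d₁.snd ∧
      z d₁.toEdge ≠ 0 ∧ z d₂.toEdge ≠ 0 ∧ z d₃.toEdge ≠ 0 ∧
      d₁.toEdge ≠ d₂.toEdge ∧ d₁.toEdge ≠ d₃.toEdge ∧ d₂.toEdge ≠ d₃.toEdge := by
  obtain ⟨e, he⟩ := Function.ne_iff.1 h0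
  obtain ⟨d₁, rfl⟩ := Dart.exists_toEdge_eq e
  obtain ⟨d₂, h₂, h₂', h₂''⟩ := exists_dart_ne_of_bdry_eq_zero hz he
  obtain ⟨d₃, h₃, h₃', h₃''⟩ := exists_dart_ne_of_bdry_eq_zero (d := d₁.symm) hz (by simpa using he)
  have a1 := d₁.fst_ne_snd
  have b2 : d₂.snd ≠ d₁.snd := fun h => h₂ (Dart.ext _ _ (Prod.ext h₂' h))
  have b3 : d₃.snd ≠ d₁.fst := fun h => h₃ (Dart.ext _ _ (Prod.ext h₃' h))
  have h₃1 : d₃.fst = d₁.snd := h₃'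
  refine ⟨d₁, d₂, d₃, h₂', h₃', he, h₂'', h₃'', ?_, ?_, ?_⟩
  · exact (Dart.toEdge_ne (Or.inr b2) (Or.inl (h₂' ▸ a1))).symm
  · exact (Dart.toEdge_ne (Or.inl (h₃1 ▸ a1.symm)) (Or.inr b3)).symm
  · exact Dart.toEdge_ne (Or.inl (h₂'.symm ▸ h₃1 ▸ a1)) (Or.inr (h₃1.symm ▸ b2))

theorem three_le_card_of_bdry_eq_zero {z : G.edgeSet → ZMod 2} (hz : bdry z = 0) (h0 : z ≠ 0)
    {S : Finset G.edgeSet} (hS : ∀ e, z e ≠ 0 → e ∈ S) : 3 ≤ S.card := by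
  obtain ⟨d₁, d₂, d₃, -, -, h1, h2, h3, h12, h13, h23⟩ := exists_edges_of_bdry_eq_zero hz h0
  rw [← Finset.card_eq_three.2 ⟨_, _, _, h12, h13, h23, rfl⟩]
  refine Finset.card_le_card fun e he => ?_
  simp only [Finset.mem_insert, Finset.mem_singleton] at he
  rcases he with rfl | rfl | rfl <;> exact hS _ ‹_›

theorem eq_zero_of_card_le_two {z : G.edgeSet → ZMod 2} (hz : bdry z = 0)
    {S : Finset G.edgeSet} (hS : ∀ e, z e ≠ 0 → e ∈ S) (hc : S.card ≤ 2) : z = 0 := by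
  by_contra h
  have := three_le_card_of_bdry_eq_zero hz h hS
  omega

theorem ne_zero_of_card_eq_three {z : G.edgeSet → ZMod 2} (hz : bdry z = 0) (h0 : z ≠ 0)
    {S : Finset G.edgeSet} (hS : ∀ e, z e ≠ 0 → e ∈ S) (hc : S.card ≤ 3) {e : G.edgeSet}
    (he : e ∈ S) : z e ≠ 0 := by
  intro hze
  have := three_le_card_of_bdry_eq_zero hz h0 (S := S.erase e) fun e' he' =>
    Finset.mem_erase.2 ⟨fun h => he' (h ▸ hze), hS e' he'⟩
  have := Finset.card_erase_lt_of_mem he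
  omega

/-- Among any four edges there are three that form a forest. -/
theorem exists_forest_of_four_le {S : Finset G.edgeSet} (hS : 4 ≤ S.card) :
    ∃ D ⊆ S, D.card = 3 ∧
      ∀ z : G.edgeSet → ZMod 2, (∀ e, z e ≠ 0 → e ∈ D) → bdry z = 0 → z = 0 := by
  obtain ⟨T, hT, hT4⟩ := Finset.exists_subset_card_eq hS
  obtain ⟨e₁, e₂, e₃, e₄, h12, h13, h14, h23, h24, h34, rfl⟩ := Finset.card_eq_four.1 hT4
  have m1 : e₁ ∈ S := hT (by simp)
  have m2 : e₂ ∈ S := hT (by simp)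
  have m3 : e₃ ∈ S := hT (by simp)
  have m4 : e₄ ∈ S := hT (by simp)
  have c3 : ({e₁, e₂, e₃} : Finset G.edgeSet).card = 3 := Finset.card_eq_three.2
    ⟨_, _, _, h12, h13, h23, rfl⟩
  have c4 : ({e₁, e₂, e₄} : Finset G.edgeSet).card = 3 := Finset.card_eq_three.2
    ⟨_, _, _, h12, h14, h24, rfl⟩
  by_contra! h
  obtain ⟨z, hz, hz', hz0⟩ := h {e₁, e₂, e₃} (by
    intro e; simp only [Finset.mem_insert, Finset.mem_singleton]; rintro (rfl | rfl | rfl)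
    <;> assumption) c3
  obtain ⟨y, hy, hy', hy0⟩ := h {e₁, e₂, e₄} (by
    intro e; simp only [Finset.mem_insert, Finset.mem_singleton]; rintro (rfl | rfl | rfl)
    <;> assumption) c4
  have hz1 : ∀ {e}, e ∈ ({e₁, e₂, e₃} : Finset G.edgeSet) → z e = 1 := fun he =>
    (ZMod.eq_one_of_ne_zero_mod_two (ne_zero_of_card_eq_three hz' hz0 hz c3.le he))
  have hy1 : ∀ {e}, e ∈ ({e₁, e₂, e₄} : Finset G.edgeSet) → y e = 1 := fun he =>
    (ZMod.eq_one_of_ne_zero_mod_two (ne_zero_of_card_eq_three hy' hy0 hy c4.le he))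
  have hy3 : y e₃ = 0 := by
    by_contra h
    have := hy _ h
    simp [h13.symm, h23.symm, h34] at this
  -- Both cycles fill their triples, so they cancel on `e₁` and `e₂` and leave a cycle supported on
  -- two edges.
  have hsum : z + y = 0 := by
    refine eq_zero_of_card_le_two (S := {e₃, e₄}) (by rw [map_add, hz', hy', add_zero]) ?_
      Finset.card_le_two
    intro e he
    by_cases he1 : e = e₁
    · rw [he1, Pi.add_apply, hz1 (by simp), hy1 (by simp)] at he
      exact absurd (by decide) he
    by_cases he2 : e = e₂
    · rw [he2, Pi.add_apply, hz1 (by simp), hy1 (by simp)] at he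
      exact absurd (by decide) he
    have h1 := hz e
    have h2 := hy e
    simp only [Finset.mem_insert, Finset.mem_singleton, he1, he2, false_or] at h1 h2 ⊢
    by_contra! h
    exact he (by rw [Pi.add_apply, not_not.1 (mt h1 h.1), not_not.1 (mt h2 h.2), add_zero])
  have := congrFun hsum e₃
  rw [Pi.add_apply, hz1 (by simp), hy3] at this
  simp at this

/-- A cycle with three edges is a triangle. -/
theorem exists_clique_of_card_eq_three {z : G.edgeSet → ZMod 2} (hz : bdry z = 0) (h0 : z ≠ 0)
    {S : Finset G.edgeSet} (hS : ∀ e, z e ≠ 0 → e ∈ S) (hc : S.card ≤ 3) :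
    ∃ t ∈ G.cliqueFinset 3, ∀ e, z e ≠ 0 → BothEnds t e := by
  obtain ⟨d₁, d₂, d₃, h21, h31, h1, h2, h3, h12, h13, h23⟩ := exists_edges_of_bdry_eq_zero hz h0
  have hall : ∀ e, z e ≠ 0 → e = d₁.toEdge ∨ e = d₂.toEdge ∨ e = d₃.toEdge := by
    intro e he
    by_contra! h
    have : ({e, d₁.toEdge, d₂.toEdge, d₃.toEdge} : Finset G.edgeSet).card = 4 :=
      Finset.card_eq_four.2 ⟨_, _, _, _, h.1, h.2.1, h.2.2, h12, h13, h23, rfl⟩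
    have h4 : ({e, d₁.toEdge, d₂.toEdge, d₃.toEdge} : Finset G.edgeSet) ⊆ S := by
      intro e'
      simp only [Finset.mem_insert, Finset.mem_singleton]
      rintro (rfl | rfl | rfl | rfl) <;> exact hS _ ‹_›
    have := Finset.card_le_card h4
    omega
  -- The cycle continues at the far end of `d₂`; only three edges are available, so it does so along
  -- `d₃`.
  have hws : d₂.snd = d₃.snd := by
    obtain ⟨d₄, h4, h4', h4''⟩ := exists_dart_ne_of_bdry_eq_zero (d := d₂.symm) hz (by simpa using h2)
    have h4f : d₄.fst = d₂.snd := h4'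
    have hne : d₂.snd ≠ d₁.snd := fun h =>
      h12 (congrArg Dart.toEdge (Dart.ext d₁ d₂ (Prod.ext h21.symm h.symm)))
    rcases hall _ h4'' with h | h | h
    · rcases Dart.toEdge_eq_iff.1 h with rfl | rfl
      · exact absurd (h21.trans h4f) d₂.fst_ne_snd
      · exact absurd h4f.symm hne
    · rcases Dart.toEdge_eq_iff.1 h with rfl | rfl
      · exact absurd h4f d₄.fst_ne_snd
      · exact absurd rfl h4
    · rcases Dart.toEdge_eq_iff.1 h with rfl | rfl
      · exact absurd (h4f.symm.trans h31) hne
      · exact h4f.symm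
  refine ⟨{d₁.fst, d₁.snd, d₂.snd}, ?_, ?_⟩
  · rw [mem_cliqueFinset_iff, is3Clique_iff]
    exact ⟨_, _, _, d₁.adj, h21 ▸ d₂.adj, h31 ▸ hws ▸ d₃.adj, rfl⟩
  · intro e he
    rcases hall e he with rfl | rfl | rfl <;> rw [bothEnds_toEdge] <;> simp [h21, h31, ← hws]

open scoped Classical in
-- Each vertex of a triangle is an end of exactly two of its edges. Equality in the count follows
-- from `three_le_card_of_bdry_eq_zero`.
theorem card_bothEnds_le_three {t : Finset V} (ht : t ∈ G.cliqueFinset 3) :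
    (Finset.univ.filter fun e : G.edgeSet => BothEnds t e).card ≤ 3 ∧
    bdry (fun e : G.edgeSet => if BothEnds t e then (1 : ZMod 2) else 0) = 0 ∧
    (fun e : G.edgeSet => if BothEnds t e then (1 : ZMod 2) else 0) ≠ 0 := by
  rw [mem_cliqueFinset_iff, is3Clique_iff] at ht
  obtain ⟨u, v, w, huv, huw, hvw, rfl⟩ := ht
  have key : ∀ e : G.edgeSet, BothEnds {u, v, w} e ↔
      e = Dart.toEdge ⟨(u, v), huv⟩ ∨ e = Dart.toEdge ⟨(u, w), huw⟩ ∨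
        e = Dart.toEdge ⟨(v, w), hvw⟩ := by
    intro e
    constructor
    · obtain ⟨⟨⟨x, y⟩, hxy⟩, rfl⟩ := Dart.exists_toEdge_eq e
      rw [bothEnds_toEdge]
      simp only [Dart.toEdge_eq_iff, Dart.ext_iff, Prod.ext_iff, Dart.symm, Prod.swap,
        Finset.mem_insert, Finset.mem_singleton]
      have : x ≠ y := hxy.ne
      rintro ⟨rfl | rfl | rfl, rfl | rfl | rfl⟩ <;> simp_all
    · rintro (rfl | rfl | rfl) <;> rw [bothEnds_toEdge] <;> simp
  have hne := huv.ne
  have hne' := huw.ne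
  have hne'' := hvw.ne
  have n12 : Dart.toEdge (G := G) ⟨(u, v), huv⟩ ≠ Dart.toEdge ⟨(u, w), huw⟩ :=
    Dart.toEdge_ne (Or.inr hne'') (Or.inl hne')
  have n13 : Dart.toEdge (G := G) ⟨(u, v), huv⟩ ≠ Dart.toEdge ⟨(v, w), hvw⟩ :=
    Dart.toEdge_ne (Or.inl hne) (Or.inl hne')
  have n23 : Dart.toEdge (G := G) ⟨(u, w), huw⟩ ≠ Dart.toEdge ⟨(v, w), hvw⟩ :=
    Dart.toEdge_ne (Or.inl hne) (Or.inl hne')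
  have heq : (fun e : G.edgeSet => if BothEnds {u, v, w} e then (1 : ZMod 2) else 0) =
      Pi.single (Dart.toEdge ⟨(u, v), huv⟩) 1 + Pi.single (Dart.toEdge ⟨(u, w), huw⟩) 1 +
        Pi.single (Dart.toEdge ⟨(v, w), hvw⟩) 1 := by
    ext e
    simp only [key, Pi.add_apply, Pi.single_apply]
    by_cases h1 : e = Dart.toEdge ⟨(u, v), huv⟩
    · subst h1; simp [n12, n13]
    by_cases h2 : e = Dart.toEdge ⟨(u, w), huw⟩
    · subst h2; simp [n12.symm, n23]
    simp [h1, h2]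
  refine ⟨?_, ?_, ?_⟩
  · refine (Finset.card_le_card (t := {Dart.toEdge ⟨(u, v), huv⟩, Dart.toEdge ⟨(u, w), huw⟩,
      Dart.toEdge ⟨(v, w), hvw⟩}) fun e he => ?_).trans Finset.card_le_three
    simpa [key] using he
  · rw [heq, map_add, map_add, bdry_single, bdry_single, bdry_single]
    change Pi.single u 1 + Pi.single v 1 + (Pi.single u 1 + Pi.single w 1) +
      (Pi.single v 1 + Pi.single w 1) = (0 : V → ZMod 2)
    have hu := ZMod.fun_add_self (Pi.single u 1 : V → ZMod 2)
    have hv := ZMod.fun_add_self (Pi.single v 1 : V → ZMod 2)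
    have hw := ZMod.fun_add_self (Pi.single w 1 : V → ZMod 2)
    linear_combination hu + hv + hw
  · intro h
    have := congrFun h (Dart.toEdge ⟨(u, v), huv⟩)
    simp [key] at this

end SimpleGraph

/-! ### Weights of sets of vertices and faces -/

namespace RootedPlaneGraph

open SimpleGraph

variable {V : Type*} {G : SimpleGraph V} (M : RootedPlaneGraph G)

theorem snd_mem_of_faceOf_mem {W : Finset V} {U : Finset M.Face}
    (hUW : ∀ d : G.Dart, M.faceOf d ∈ U → d.fst ∈ W) (d : G.Dart) (h : M.faceOf d ∈ U) :
    d.snd ∈ W := by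
  rw [← M.facePerm_fst]
  exact hUW _ (by rwa [M.faceOf_facePerm])

theorem bothEnds_of_someSide {W : Finset V} {U : Finset M.Face}
    (hUW : ∀ d : G.Dart, M.faceOf d ∈ U → d.fst ∈ W) {e : G.edgeSet} (h : M.SomeSide U e) :
    BothEnds W e := by
  rcases h with h | h
  · exact ⟨hUW _ h, M.snd_mem_of_faceOf_mem hUW _ h⟩
  · exact ⟨M.snd_mem_of_faceOf_mem hUW _ h, hUW _ h⟩

theorem bothSides_of_not_noEnd {W : Finset V} {U : Finset M.Face}
    (hWU : ∀ d : G.Dart, d.fst ∈ W → M.faceOf d ∈ U) {e : G.edgeSet} (h : ¬ NoEnd W e) :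
    M.BothSides U e := by
  have key : ∀ d : G.Dart, d.fst ∈ W → M.faceOf d ∈ U ∧ M.faceOf d.symm ∈ U := fun d hd =>
    ⟨hWU d hd, by rw [← M.faceOf_next]; exact hWU _ (by rwa [M.next_fst])⟩
  rw [NoEnd, not_and_or, not_not, not_not] at h
  rcases h with h | h
  · exact key _ h
  · exact (key (edgeDart e).symm h).symm

open scoped Classical in
/-- The indicator function of a set of faces modulo 2. -/
noncomputable def indic (U : Finset M.Face) (p : M.Face) : ZMod 2 := if p ∈ U then 1 else 0

theorem faceBdry_indic_ne_zero (U : Finset M.Face) (e : G.edgeSet) :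
    M.faceBdry (M.indic U) e ≠ 0 ↔ M.SomeSide U e ∧ ¬ M.BothSides U e := by
  change M.indic U _ + M.indic U _ ≠ 0 ↔ _
  unfold SomeSide BothSides indic
  by_cases h1 : M.faceOf (edgeDart e) ∈ U <;> by_cases h2 : M.faceOf (edgeDart e).symm ∈ U <;>
    simp [h1, h2, CharTwo.add_self_eq_zero]

theorem faceBdry_indic_ne_zero_of_nonempty [Finite G.Dart] {U : Finset M.Face}
    (hU : ∀ p ∈ M.outer, p ∉ U) (hne : U.Nonempty) : M.faceBdry (M.indic U) ≠ 0 := by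
  intro h
  obtain ⟨p, hp⟩ := hne
  have := congrFun (M.eq_zero_of_faceBdry_eq_zero (fun p hp => by simp [indic, hU p hp]) h) p
  simp [indic, hp] at this

variable [Fintype V] [DecidableEq V] [DecidableRel G.Adj]

open scoped Classical in
/-- The edges with both sides in `U`. -/
noncomputable def innerEdges (U : Finset M.Face) : Finset G.edgeSet :=
  Finset.univ.filter (M.BothSides U)

open scoped Classical in
/-- The edges with some side in `U`. -/
noncomputable def sideEdges (U : Finset M.Face) : Finset G.edgeSet :=
  Finset.univ.filter (M.SomeSide U)

open scoped Classical in
/-- The edges with both ends in `W` and no side in `U`. -/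
noncomputable def barEdges (W : Finset V) (U : Finset M.Face) : Finset G.edgeSet :=
  Finset.univ.filter fun e => BothEnds W e ∧ ¬ M.SomeSide U e

open scoped Classical in
/-- The edges with both sides in `U` and no end in `W`. -/
noncomputable def chordEdges (W : Finset V) (U : Finset M.Face) : Finset G.edgeSet :=
  Finset.univ.filter fun e => M.BothSides U e ∧ NoEnd W e

theorem mem_innerEdges {U : Finset M.Face} {e : G.edgeSet} :
    e ∈ M.innerEdges U ↔ M.BothSides U e := by simp [innerEdges]

theorem mem_sideEdges {U : Finset M.Face} {e : G.edgeSet} :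
    e ∈ M.sideEdges U ↔ M.SomeSide U e := by simp [sideEdges]

theorem mem_barEdges {W : Finset V} {U : Finset M.Face} {e : G.edgeSet} :
    e ∈ M.barEdges W U ↔ BothEnds W e ∧ ¬ M.SomeSide U e := by simp [barEdges]

theorem mem_chordEdges {W : Finset V} {U : Finset M.Face} {e : G.edgeSet} :
    e ∈ M.chordEdges W U ↔ M.BothSides U e ∧ NoEnd W e := by simp [chordEdges]

open scoped Classical in
-- Let `S` be the edges inside `W` with a side outside `U`. Up to two of them may join the inner
-- edges in `card_add_one_le`: a chain off `U` has zero boundary on inner edges, and a cycle on two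
-- edges is zero. If `S` has only one edge, the missing unit is supplied by a bar edge.
theorem card_innerEdges_add_three_le {W : Finset V} {U : Finset M.Face}
    (hU : ∀ p ∈ M.outer, p ∉ U) (hUW : ∀ d : G.Dart, M.faceOf d ∈ U → d.fst ∈ W)
    (hW : ∃ e, BothEnds (G := G) W e) :
    (M.innerEdges U).card + 3 ≤ W.card + U.card + (M.barEdges W U).card := by
  obtain ⟨e₀, he₀⟩ := hW
  have hWne : W.Nonempty := ⟨_, he₀.1⟩
  have hD : ∀ S' : Finset G.edgeSet, S'.card ≤ 2 →
      (∀ e ∈ S', BothEnds W e ∧ ¬ M.BothSides U e) →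
      (M.innerEdges U).card + S'.card + 1 ≤ W.card + U.card := by
    intro S' hc hS'
    rw [← Finset.card_union_of_disjoint]
    · refine M.card_add_one_le hWne (fun e he => ?_) fun c hout hcU hsupp => ?_
      · rcases Finset.mem_union.1 he with he | he
        · exact M.bothEnds_of_someSide hUW (Or.inl (Finset.mem_filter.1 he).2.1)
        · exact (hS' e he).1
      · refine M.eq_zero_of_faceBdry_eq_zero hout
          (eq_zero_of_card_le_two (M.bdry_faceBdry c) (S := S') (fun e he => ?_) hc)
        rcases Finset.mem_union.1 (hsupp e he) with h | h
        · refine absurd ?_ he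
          have := (Finset.mem_filter.1 h).2
          change c _ + c _ = 0
          rw [hcU _ this.1, hcU _ this.2, add_zero]
        · exact h
    · rw [Finset.disjoint_left]
      exact fun e he he' => (hS' e he').2 (Finset.mem_filter.1 he).2
  set S := Finset.univ.filter fun e : G.edgeSet => BothEnds W e ∧ ¬ M.BothSides U e with hS
  have hSmem : ∀ e, e ∈ S ↔ BothEnds W e ∧ ¬ M.BothSides U e := by simp [hS]
  rcases Nat.lt_or_ge S.card 2 with hlt | hge
  · have hSne : S.Nonempty := by
      by_contra hemp
      have hall : ∀ d : G.Dart, d.fst ∈ W ∧ d.snd ∈ W → M.faceOf d ∈ U ∧ M.faceOf d.symm ∈ U := by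
        intro d hd
        by_contra h
        exact hemp ⟨d.toEdge, (hSmem _).2 ⟨(bothEnds_toEdge W d).2 hd,
          fun h' => h ((M.bothSides_toEdge U d).1 h')⟩⟩
      -- If `S` were empty, the edges inside `W` would make up a whole component, and its walk on
      -- the unbounded face would belong to `U`.
      refine M.not_of_not_outer (P := fun d => d.fst ∈ W ∧ d.snd ∈ W) (fun d hd => ?_)
        (fun d hd => hd.symm) (fun d hd h => hU _ hd (hall d h).1) (edgeDart e₀) he₀
      have := (hall d hd).2
      rw [← M.faceOf_next] at this
      exact ⟨by rw [M.next_fst]; exact hd.1, M.snd_mem_of_faceOf_mem hUW _ this⟩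
    obtain ⟨e, he⟩ := Finset.card_eq_one.1 (show S.card = 1 by
      have := hSne.card_pos; omega)
    have heS := (hSmem e).1 (by simp [he])
    have := hD {e} (by simp) (by simpa using heS)
    rw [Finset.card_singleton] at this
    -- The boundary of `U` is a cycle supported in `S`, so the single edge of `S` is not on it and
    -- has no side in `U`.
    have hbar : 0 < (M.barEdges W U).card := by
      refine Finset.card_pos.2 ⟨e, ?_⟩
      rw [barEdges, Finset.mem_filter]
      refine ⟨Finset.mem_univ _, heS.1, fun hside => ?_⟩
      have h0 : M.faceBdry (M.indic U) e ≠ 0 := (M.faceBdry_indic_ne_zero U e).2 ⟨hside, heS.2⟩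
      refine h0 (congrFun (eq_zero_of_card_le_two (M.bdry_faceBdry _) (S := S) (fun e' he' => ?_)
        (by omega)) e)
      have := (M.faceBdry_indic_ne_zero U e').1 he'
      exact (hSmem _).2 ⟨M.bothEnds_of_someSide hUW this.1, this.2⟩
    omega
  · obtain ⟨S', hS', hc⟩ := Finset.exists_subset_card_eq hge
    have := hD S' hc.le fun e he => (hSmem e).1 (hS' he)
    omega

open scoped Classical in
/-- The vertices all of whose faces belong to `U`. -/
noncomputable def inside (U : Finset M.Face) : Finset V :=
  Finset.univ.filter fun v => ¬ G.IsIsolated v ∧ ∀ d : G.Dart, d.fst = v → M.faceOf d ∈ U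

theorem mem_inside {U : Finset M.Face} {v : V} :
    v ∈ M.inside U ↔ ¬ G.IsIsolated v ∧ ∀ d : G.Dart, d.fst = v → M.faceOf d ∈ U := by
  simp [inside]

theorem faceOf_mem_of_mem_inside {U : Finset M.Face} (d : G.Dart) (h : d.fst ∈ M.inside U) :
    M.faceOf d ∈ U := (M.mem_inside.1 h).2 d rfl

open scoped Classical in
theorem card_inside_add_card_add_le {U : Finset M.Face} (hU : ∀ p ∈ M.outer, p ∉ U)
    {D : Finset G.edgeSet} (hD : ∀ e ∈ D, M.SomeSide U e ∧ ¬ M.BothSides U e)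
    (hacyc : ∀ z : G.edgeSet → ZMod 2, (∀ e, z e ≠ 0 → e ∈ D) → bdry z = 0 → z = 0) :
    (M.inside U).card + U.card + D.card ≤ (M.sideEdges U).card := by
  refine M.card_add_card_add_card_le hU (fun v hv => (M.mem_inside.1 hv).1)
    M.faceOf_mem_of_mem_inside (fun e he => ⟨(hD e he).1, ?_⟩) hacyc
  by_contra h
  exact (hD e he).2 (M.bothSides_of_not_noEnd M.faceOf_mem_of_mem_inside h)

open scoped Classical in
-- The boundary of `U` is a nonzero cycle, so it has at least three edges, and any two of them form
-- a forest. With four or more edges, three form a forest and the bound improves by one.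
theorem card_inside_add_two_le {U : Finset M.Face} (hU : ∀ p ∈ M.outer, p ∉ U)
    (hne : U.Nonempty) : (M.inside U).card + U.card + 2 ≤ (M.sideEdges U).card ∧
    ((M.sideEdges U).card ≤ (M.inside U).card + U.card + 2 →
      ∃ t ∈ G.cliqueFinset 3, ∀ e, M.faceBdry (M.indic U) e ≠ 0 ↔ BothEnds t e) := by
  set S := Finset.univ.filter fun e => M.SomeSide U e ∧ ¬ M.BothSides U e with hS
  have hSmem : ∀ e, e ∈ S ↔ M.SomeSide U e ∧ ¬ M.BothSides U e := by simp [hS]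
  have h0 := M.faceBdry_indic_ne_zero_of_nonempty hU hne
  have hz := M.bdry_faceBdry (M.indic U)
  have hsupp : ∀ e, M.faceBdry (M.indic U) e ≠ 0 → e ∈ S := fun e he =>
    (hSmem e).2 ((M.faceBdry_indic_ne_zero U e).1 he)
  have h3 := three_le_card_of_bdry_eq_zero hz h0 hsupp
  constructor
  · obtain ⟨D, hD, hc⟩ := Finset.exists_subset_card_eq (show 2 ≤ S.card by omega)
    rw [← hc]
    exact M.card_inside_add_card_add_le hU (fun e he => (hSmem e).1 (hD he))
      fun z hz hz' => eq_zero_of_card_le_two hz' hz hc.le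
  · intro hle
    have hc : S.card ≤ 3 := by
      by_contra hlt
      obtain ⟨D, hD, hc, hacyc⟩ := exists_forest_of_four_le (S := S) (by omega)
      have := M.card_inside_add_card_add_le hU (fun e he => (hSmem e).1 (hD he)) hacyc
      omega
    obtain ⟨t, ht, h⟩ := exists_clique_of_card_eq_three hz h0 hsupp hc
    refine ⟨t, ht, fun e => ⟨h e, fun he => ?_⟩⟩
    obtain ⟨hc3, -, -⟩ := card_bothEnds_le_three ht
    exact ne_zero_of_card_eq_three hz h0 (S := Finset.univ.filter fun e => BothEnds t e)
      (by simpa using h) hc3 (by simpa using he)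

open scoped Classical in
/-- Every triangle is the boundary of a unique set of bounded faces, which has the least possible
number of edges. -/
theorem exists_faces_of_clique {t : Finset V} (ht : t ∈ G.cliqueFinset 3) :
    ∃ U : Finset M.Face, (∀ p ∈ M.outer, p ∉ U) ∧
      (∀ e, M.faceBdry (M.indic U) e ≠ 0 ↔ BothEnds t e) ∧
      (M.sideEdges U).card ≤ (M.inside U).card + U.card + 2 ∧
      M.chordEdges (M.inside U) U = ∅ ∧ U.Nonempty := by
  obtain ⟨hc3, hχ, hχ0⟩ := card_bothEnds_le_three ht
  set χ : G.edgeSet → ZMod 2 := fun e => if BothEnds t e then 1 else 0 with hχdef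
  obtain ⟨L, hL⟩ := M.exists_filling
  obtain ⟨hLout, hLχ⟩ := hL χ hχ
  set U : Finset M.Face := Finset.univ.filter fun p => L χ p ≠ 0 with hUdef
  have hind : M.indic U = L χ := by
    ext p
    unfold indic
    by_cases h : L χ p = 0
    · simp [hUdef, h]
    · simp [hUdef, ZMod.eq_one_of_ne_zero_mod_two h]
  have hU : ∀ p ∈ M.outer, p ∉ U := fun p hp => by simp [hUdef, hLout p hp]
  have hbd : ∀ e, M.faceBdry (M.indic U) e ≠ 0 ↔ BothEnds t e := by
    intro e
    rw [hind, hLχ, hχdef]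
    simp
  have hne : U.Nonempty := by
    by_contra h
    rw [Finset.not_nonempty_iff_eq_empty] at h
    apply hχ0
    rw [← hLχ, ← hind, h]
    ext e
    simp [RotationSystem.faceBdry, indic]
  -- Turning around a vertex off `t` crosses no edge of the triangle, and so never leaves `U`.
  have hfst : ∀ d : G.Dart, M.faceOf d ∈ U → d.fst ∈ M.inside U ∪ t := by
    intro d hd
    by_contra hcon
    rw [Finset.mem_union, not_or] at hcon
    refine hcon.1 (M.mem_inside.2 ⟨not_isIsolated_fst d, fun d' hd' => ?_⟩)
    refine (M.rotation_induction (P := fun d' => d'.fst = d.fst ∧ M.faceOf d' ∈ U)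
      (fun d' hd' => ⟨by rw [M.next_fst, hd'.1], ?_⟩) hd'.symm ⟨rfl, hd⟩).2
    rw [M.faceOf_next]
    by_contra h
    have := (hbd d'.toEdge).1 ((M.faceBdry_indic_ne_zero _ _).2
      ⟨(M.someSide_toEdge _ _).2 (Or.inl hd'.2), fun h' => h ((M.bothSides_toEdge _ _).1 h').2⟩)
    exact hcon.2 (hd'.1 ▸ ((bothEnds_toEdge _ _).1 this).1)
  refine ⟨U, hU, hbd, ?_, ?_, hne⟩
  · have ht3 : t.card = 3 := (mem_cliqueFinset_iff.1 ht).card_eq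
    obtain ⟨x, hx⟩ : t.Nonempty := Finset.card_pos.1 (by omega)
    have := M.card_add_one_le (W := M.inside U ∪ t) (U := U) (D := M.sideEdges U)
      ⟨x, Finset.mem_union_right _ hx⟩
      (fun e he => M.bothEnds_of_someSide hfst (Finset.mem_filter.1 he).2) ?_
    · have := Finset.card_union_le (M.inside U) t
      omega
    · intro c hout hcU hsupp
      have hsupp' : ∀ e, M.faceBdry c e ≠ 0 →
          e ∈ Finset.univ.filter fun e => BothEnds (G := G) t e := by
        intro e he
        rw [Finset.mem_filter, ← hbd, M.faceBdry_indic_ne_zero]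
        refine ⟨Finset.mem_univ _, (Finset.mem_filter.1 (hsupp e he)).2, fun h => he ?_⟩
        change c _ + c _ = 0
        rw [hcU _ h.1, hcU _ h.2, add_zero]
      -- A nonzero `c` would have the whole triangle as boundary and so be the filling `L χ`, which
      -- is nonzero on `U`, where `c` vanishes.
      by_contra hc
      have hc0 : M.faceBdry c ≠ 0 := fun h => hc (M.eq_zero_of_faceBdry_eq_zero hout h)
      have hcχ : M.faceBdry c = χ := by
        ext e
        by_cases he : BothEnds t e
        · have := ne_zero_of_card_eq_three (M.bdry_faceBdry c) hc0 hsupp' hc3 (e := e)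
            (by simpa using he)
          simp [hχdef, he, ZMod.eq_one_of_ne_zero_mod_two this]
        · have : M.faceBdry c e = 0 := by
            by_contra h
            exact he (by simpa using hsupp' e h)
          simp [hχdef, he, this]
      have hcL : c - L χ = 0 := M.eq_zero_of_faceBdry_eq_zero
        (fun p hp => by simp [hout p hp, hLout p hp]) (by rw [map_sub, hcχ, hLχ, sub_self])
      obtain ⟨p, hp⟩ := hne
      have h1 := congrFun hcL p
      rw [Pi.sub_apply, hcU p hp, zero_sub, Pi.zero_apply, neg_eq_zero] at h1
      exact (Finset.mem_filter.1 hp).2 h1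
  · rw [Finset.eq_empty_iff_forall_notMem]
    intro e he
    obtain ⟨-, hboth, hno⟩ := Finset.mem_filter.1 he
    obtain ⟨h1, h2⟩ := M.bothEnds_of_someSide hfst (Or.inl hboth.1)
    have := (hbd e).2 ⟨(Finset.mem_union.1 h1).resolve_left hno.1,
      (Finset.mem_union.1 h2).resolve_left hno.2⟩
    exact ((M.faceBdry_indic_ne_zero _ _).1 this).2 hboth

end RootedPlaneGraph

/-! ### The quadratic form -/

open scoped Classical in
/-- The integer valued indicator function of a finset. -/
noncomputable def Finset.ind {α : Type*} (S : Finset α) (x : α) : ℤ := if x ∈ S then 1 else 0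

theorem Finset.sum_ind {α : Type*} [Fintype α] (S : Finset α) : ∑ x, S.ind x = S.card := by
  classical
  simp [Finset.ind]

namespace RootedPlaneGraph

open SimpleGraph

variable {V : Type*} {G : SimpleGraph V} (M : RootedPlaneGraph G)

variable {M} in
theorem Admissible.corner_snd_nonneg {a : M.Face → ℤ} {b : V → ℤ} (h : M.Admissible a b)
    (d : G.Dart) : 0 ≤ a (M.faceOf d) + b d.snd := by
  have := h.corner_nonneg (M.facePerm d)
  rwa [M.faceOf_facePerm, M.facePerm_fst] at this

variable [Fintype V] [DecidableEq V] [DecidableRel G.Adj]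

/-- The quadratic form `A + B`, written as a sum over darts. -/
noncomputable def form (a : M.Face → ℤ) (b : V → ℤ) : ℤ :=
  ∑ d : G.Dart, ((a (M.faceOf d) + b d.fst) * (a (M.faceOf d) + b d.snd) + a (M.faceOf d)) +
    2 * ∑ v, b v - 2 * ∑ p, a p

theorem sum_corners (F : G.Dart → ℤ) : ∑ p : M.Face, ∑ d ∈ M.corners p, F d = ∑ d, F d := by
  classical
  rw [← Finset.sum_fiberwise Finset.univ M.faceOf F]
  refine Finset.sum_congr rfl fun p _ => Finset.sum_congr ?_ fun _ _ => rfl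
  ext d
  simp [corners]

theorem sum_boundedFaces {F : M.Face → ℤ} (hF : ∀ p ∈ M.outer, F p = 0) :
    ∑ p ∈ M.boundedFaces, F p = ∑ p, F p := by
  refine Finset.sum_subset (Finset.subset_univ _) fun p _ hp => hF p ?_
  simpa [boundedFaces] using hp

theorem sum_length_mul (F : M.Face → ℤ) :
    ∑ p, (M.length p : ℤ) * F p = ∑ d : G.Dart, F (M.faceOf d) := by
  rw [← M.sum_corners]
  refine Finset.sum_congr rfl fun p _ => ?_
  rw [length, ← nsmul_eq_mul, ← Finset.sum_const]
  refine Finset.sum_congr rfl fun d hd => ?_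
  rw [(by simpa [corners] using hd : M.faceOf d = p)]

theorem _root_.SimpleGraph.two_mul_sum_edge_mul (b : V → ℤ) :
    2 * ∑ e ∈ G.edgeFinset, (e.map b).mul = ∑ d : G.Dart, b d.fst * b d.snd := by
  rw [sum_dart_eq_sum_edge, Finset.mul_sum,
    Finset.sum_subtype G.edgeFinset (p := (· ∈ G.edgeSet)) (fun _ => mem_edgeFinset)]
  refine Finset.sum_congr rfl fun e _ => ?_
  have : e.1 = s((edgeDart e).fst, (edgeDart e).snd) := by
    conv_lhs => rw [← toEdge_edgeDart e]
    rfl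
  rw [this]
  simp only [Sym2.map_mk, Sym2.mul_mk, Dart.symm, Prod.fst_swap, Prod.snd_swap]
  ring

/-- Along a closed boundary walk the end points are the initial points shifted by one step. -/
theorem sum_mul_snd (a : M.Face → ℤ) (b : V → ℤ) :
    ∑ d : G.Dart, a (M.faceOf d) * b d.snd = ∑ d : G.Dart, a (M.faceOf d) * b d.fst := by
  refine Eq.trans (Finset.sum_congr rfl fun d _ => ?_)
    (M.facePerm.sum_comp Finset.univ (fun d => a (M.faceOf d) * b d.fst) (by simp))
  rw [M.faceOf_facePerm, M.facePerm_fst]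

theorem A_eq {a : M.Face → ℤ} (ha : ∀ p ∈ M.outer, a p = 0) (b : V → ℤ) :
    M.A a b = ∑ d : G.Dart, (a (M.faceOf d) ^ 2 + 2 * (a (M.faceOf d) * b d.fst) +
      b d.fst * b d.snd) := by
  rw [A, M.sum_boundedFaces (fun p hp => by simp [gamma, ha p hp]), two_mul_sum_edge_mul]
  simp only [gamma, Finset.sum_add_distrib]
  rw [M.sum_length_mul (fun p => a p ^ 2), ← M.sum_corners fun d => 2 * (a (M.faceOf d) * b d.fst)]
  congr 2
  refine Finset.sum_congr rfl fun p _ => ?_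
  rw [Finset.mul_sum]
  refine Finset.sum_congr rfl fun d hd => ?_
  rw [(by simpa [corners] using hd : M.faceOf d = p), mul_assoc]

theorem B_eq {a : M.Face → ℤ} (ha : ∀ p ∈ M.outer, a p = 0) (b : V → ℤ) :
    M.B a b = 2 * ∑ v, b v + ∑ d : G.Dart, a (M.faceOf d) - 2 * ∑ p, a p := by
  rw [B, M.sum_boundedFaces (fun p hp => by simp [ha p hp]), ← M.sum_length_mul]
  simp only [sub_mul, Finset.sum_sub_distrib, Finset.mul_sum]
  ring

theorem A_add_B_eq {a : M.Face → ℤ} (ha : ∀ p ∈ M.outer, a p = 0) (b : V → ℤ) :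
    M.A a b + M.B a b = M.form a b := by
  have h : ∑ d : G.Dart, ((a (M.faceOf d) + b d.fst) * (a (M.faceOf d) + b d.snd) +
      a (M.faceOf d)) = ∑ d : G.Dart, (a (M.faceOf d) ^ 2 + a (M.faceOf d) * b d.fst +
      a (M.faceOf d) * b d.snd + b d.fst * b d.snd + a (M.faceOf d)) :=
    Finset.sum_congr rfl fun d _ => by ring
  rw [M.A_eq ha, M.B_eq ha, form, h]
  simp only [Finset.sum_add_distrib, ← Finset.mul_sum, M.sum_mul_snd]
  ring

theorem even_form (a : M.Face → ℤ) (b : V → ℤ) : Even (M.form a b) := by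
  have h : M.form a b = ∑ d : G.Dart, a (M.faceOf d) * (a (M.faceOf d) + 1) +
      2 * (∑ d : G.Dart, a (M.faceOf d) * b d.fst + ∑ e ∈ G.edgeFinset, (e.map b).mul +
        ∑ v, b v - ∑ p, a p) := by
    have h : ∑ d : G.Dart, ((a (M.faceOf d) + b d.fst) * (a (M.faceOf d) + b d.snd) +
        a (M.faceOf d)) = ∑ d : G.Dart, (a (M.faceOf d) * (a (M.faceOf d) + 1) +
        a (M.faceOf d) * b d.fst + a (M.faceOf d) * b d.snd + b d.fst * b d.snd) :=
      Finset.sum_congr rfl fun d _ => by ring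
    rw [form, h]
    simp only [Finset.sum_add_distrib, M.sum_mul_snd, ← two_mul_sum_edge_mul]
    ring
  rw [h]
  exact (Finset.even_sum _ fun d _ => Int.even_mul_succ_self _).add (even_two_mul _)

/-- The form is quadratic plus linear, and its cross terms are products of corner values of the two
states. -/
theorem form_add_le {a a' : M.Face → ℤ} {b b' : V → ℤ} (h : M.Admissible a b)
    (h' : M.Admissible a' b') :
    M.form a b + M.form a' b' ≤ M.form (a + a') (b + b') := by
  have key : 0 ≤ ∑ d : G.Dart, ((a (M.faceOf d) + b d.fst) * (a' (M.faceOf d) + b' d.snd) +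
      (a' (M.faceOf d) + b' d.fst) * (a (M.faceOf d) + b d.snd)) :=
    Finset.sum_nonneg fun d _ => add_nonneg
      (mul_nonneg (h.corner_nonneg d) (h'.corner_snd_nonneg d))
      (mul_nonneg (h'.corner_nonneg d) (h.corner_snd_nonneg d))
  have : M.form (a + a') (b + b') = M.form a b + M.form a' b' +
      ∑ d : G.Dart, ((a (M.faceOf d) + b d.fst) * (a' (M.faceOf d) + b' d.snd) +
      (a' (M.faceOf d) + b' d.fst) * (a (M.faceOf d) + b d.snd)) := by
    have h1 : ∀ d : G.Dart, ((a + a') (M.faceOf d) + (b + b') d.fst) *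
        ((a + a') (M.faceOf d) + (b + b') d.snd) + (a + a') (M.faceOf d) =
        ((a (M.faceOf d) + b d.fst) * (a (M.faceOf d) + b d.snd) + a (M.faceOf d)) +
        ((a' (M.faceOf d) + b' d.fst) * (a' (M.faceOf d) + b' d.snd) + a' (M.faceOf d)) +
        ((a (M.faceOf d) + b d.fst) * (a' (M.faceOf d) + b' d.snd) +
      (a' (M.faceOf d) + b' d.fst) * (a (M.faceOf d) + b d.snd)) := fun d => by
      simp only [Pi.add_apply]; ring
    rw [form, Finset.sum_congr rfl fun d _ => h1 d]
    simp only [form, Pi.add_apply, Finset.sum_add_distrib]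
    ring
  omega

theorem form_zero_left (b : V → ℤ) :
    M.form 0 b = ∑ d : G.Dart, b d.fst * b d.snd + 2 * ∑ v, b v := by
  simp [form]

open scoped Classical in
-- The two darts of an edge contribute -2 together if both sides are in `U`, 2 for a bar edge, and 0
-- otherwise; on an edge with one side in `U` they cancel.
theorem form_neg_ind_ind {W : Finset V} {U : Finset M.Face}
    (hUW : ∀ d : G.Dart, M.faceOf d ∈ U → d.fst ∈ W) :
    M.form (-U.ind) W.ind =
      2 * (W.card + U.card + (M.barEdges W U).card - (M.innerEdges U).card) := by
  have hsnd := M.snd_mem_of_faceOf_mem hUW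
  rw [form, sum_dart_eq_sum_edge]
  have : ∀ e : G.edgeSet, _ = 2 * ((M.barEdges W U).ind e - (M.innerEdges U).ind e) := fun e => by
    have h1 := hUW (edgeDart e)
    have h2 := hUW (edgeDart e).symm
    have h3 := hsnd (edgeDart e)
    have h4 := hsnd (edgeDart e).symm
    change (fun d : G.Dart => ((-U.ind) (M.faceOf d) + W.ind d.fst) *
      ((-U.ind) (M.faceOf d) + W.ind d.snd) + (-U.ind) (M.faceOf d)) (edgeDart e) +
      (fun d : G.Dart => ((-U.ind) (M.faceOf d) + W.ind d.fst) *
      ((-U.ind) (M.faceOf d) + W.ind d.snd) + (-U.ind) (M.faceOf d)) (edgeDart e).symm = _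
    simp only [Finset.ind, Pi.neg_apply, mem_barEdges, mem_innerEdges, BothEnds, SomeSide, BothSides, Dart.symm, Prod.fst_swap,
      Prod.snd_swap] at *
    by_cases c1 : M.faceOf (edgeDart e) ∈ U <;> by_cases c2 : M.faceOf (edgeDart e).symm ∈ U <;>
      by_cases c3 : (edgeDart e).fst ∈ W <;> by_cases c4 : (edgeDart e).snd ∈ W <;>
      simp_all [Dart.symm]
  rw [Finset.sum_congr rfl fun e _ => this e, ← Finset.mul_sum, Finset.sum_sub_distrib,
    Finset.sum_ind, Finset.sum_ind, Finset.sum_ind]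
  simp only [Pi.neg_apply, Finset.sum_neg_distrib, Finset.sum_ind]
  ring

open scoped Classical in
-- An edge with exactly one side in `U` has no end in `W` and contributes 2. With both sides in `U`
-- it contributes 2, or 4 if it has no end in `W`.
theorem form_ind_neg_ind {W : Finset V} {U : Finset M.Face}
    (hWU : ∀ d : G.Dart, d.fst ∈ W → M.faceOf d ∈ U) :
    M.form U.ind (-W.ind) =
      2 * ((M.sideEdges U).card + (M.chordEdges W U).card - W.card - U.card) := by
  rw [form, sum_dart_eq_sum_edge]
  have : ∀ e : G.edgeSet, _ = 2 * ((M.sideEdges U).ind e + (M.chordEdges W U).ind e) := fun e => by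
    have h1 := M.bothSides_of_not_noEnd hWU (e := e)
    change (fun d : G.Dart => (U.ind (M.faceOf d) + (-W.ind) d.fst) *
      (U.ind (M.faceOf d) + (-W.ind) d.snd) + U.ind (M.faceOf d)) (edgeDart e) +
      (fun d : G.Dart => (U.ind (M.faceOf d) + (-W.ind) d.fst) *
      (U.ind (M.faceOf d) + (-W.ind) d.snd) + U.ind (M.faceOf d)) (edgeDart e).symm = _
    simp only [Finset.ind, Pi.neg_apply, mem_sideEdges, mem_chordEdges, NoEnd, SomeSide, BothSides, Dart.symm, Prod.fst_swap,
      Prod.snd_swap] at *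
    by_cases c1 : M.faceOf (edgeDart e) ∈ U <;> by_cases c2 : M.faceOf (edgeDart e).symm ∈ U <;>
      by_cases c3 : (edgeDart e).fst ∈ W <;> by_cases c4 : (edgeDart e).snd ∈ W <;>
      simp_all [Dart.symm]
  rw [Finset.sum_congr rfl fun e _ => this e, ← Finset.mul_sum, Finset.sum_add_distrib,
    Finset.sum_ind, Finset.sum_ind, Finset.sum_ind]
  simp only [Pi.neg_apply, Finset.sum_neg_distrib, Finset.sum_ind]
  ring

end RootedPlaneGraph

/-! ### States of low weight -/

theorem Finset.ind_of_mem {α : Type*} {S : Finset α} {x : α} (h : x ∈ S) : S.ind x = 1 := if_pos h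

theorem Finset.ind_of_notMem {α : Type*} {S : Finset α} {x : α} (h : x ∉ S) : S.ind x = 0 :=
  if_neg h

theorem Finset.ind_eq_zero_or_one {α : Type*} (S : Finset α) (x : α) :
    S.ind x = 0 ∨ S.ind x = 1 := by
  by_cases h : x ∈ S
  · exact Or.inr (ind_of_mem h)
  · exact Or.inl (ind_of_notMem h)

@[simp] theorem Finset.ind_empty {α : Type*} : (∅ : Finset α).ind = 0 := by
  ext x
  exact ind_of_notMem (Finset.notMem_empty x)

namespace RootedPlaneGraph

open SimpleGraph

variable {V : Type*} {G : SimpleGraph V} (M : RootedPlaneGraph G)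

/-- The state `b = 1` on `W`, `a = -1` on `U` is admissible. -/
structure PosLayer (W : Finset V) (U : Finset M.Face) : Prop where
  outer : ∀ p ∈ M.outer, p ∉ U
  root : M.root ∉ W
  mem : ∀ d : G.Dart, M.faceOf d ∈ U → d.fst ∈ W

/-- The state `b = -1` on `W`, `a = 1` on `U` is admissible. -/
structure NegLayer (W : Finset V) (U : Finset M.Face) : Prop where
  outer : ∀ p ∈ M.outer, p ∉ U
  isolated : ∀ v ∈ W, ¬ G.IsIsolated v
  mem : ∀ d : G.Dart, d.fst ∈ W → M.faceOf d ∈ U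

variable {M}

theorem PosLayer.admissible {W : Finset V} {U : Finset M.Face} (h : M.PosLayer W U) :
    M.Admissible (-U.ind) W.ind where
  outer_eq_zero p hp := by simp [Finset.ind_of_notMem (h.outer p hp)]
  corner_nonneg d := by
    by_cases hd : M.faceOf d ∈ U
    · simp [Finset.ind_of_mem hd, Finset.ind_of_mem (h.mem d hd)]
    · have := W.ind_eq_zero_or_one d.fst
      simp only [Pi.neg_apply, Finset.ind_of_notMem hd]
      omega
  isolated_nonneg v _ := by have := W.ind_eq_zero_or_one v; omega
  root_eq_zero := Finset.ind_of_notMem h.root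

/-- The root is isolated or has a corner on the unbounded face, so `NegLayer` need not exclude it.
-/
theorem NegLayer.root {W : Finset V} {U : Finset M.Face} (h : M.NegLayer W U) : M.root ∉ W := by
  intro hr
  rcases M.root_outer with hi | ⟨d, hd, hd'⟩
  · exact h.isolated _ hr hi
  · exact h.outer _ hd' (h.mem d (hd ▸ hr))

theorem NegLayer.admissible {W : Finset V} {U : Finset M.Face} (h : M.NegLayer W U) :
    M.Admissible U.ind (-W.ind) where
  outer_eq_zero p hp := Finset.ind_of_notMem (h.outer p hp)
  corner_nonneg d := by
    by_cases hd : d.fst ∈ W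
    · simp [Finset.ind_of_mem hd, Finset.ind_of_mem (h.mem d hd)]
    · have := U.ind_eq_zero_or_one (M.faceOf d)
      simp only [Pi.neg_apply, Finset.ind_of_notMem hd]
      omega
  isolated_nonneg v hv := by simp [Finset.ind_of_notMem fun hW => h.isolated v hW hv]
  root_eq_zero := by simp [Finset.ind_of_notMem h.root]

theorem PosLayer.singleton {v : V} (h : v ≠ M.root) : M.PosLayer {v} ∅ where
  outer := by simp
  root := by simpa using h.symm
  mem := by simp

theorem admissible_zero : M.Admissible 0 0 := ⟨by simp, by simp, by simp, by simp⟩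

theorem Admissible.add {a a' : M.Face → ℤ} {b b' : V → ℤ} (h : M.Admissible a b)
    (h' : M.Admissible a' b') : M.Admissible (a + a') (b + b') where
  outer_eq_zero p hp := by simp [h.outer_eq_zero p hp, h'.outer_eq_zero p hp]
  corner_nonneg d := by
    have := h.corner_nonneg d
    have := h'.corner_nonneg d
    simp only [Pi.add_apply]
    omega
  isolated_nonneg v hv := add_nonneg (h.isolated_nonneg v hv) (h'.isolated_nonneg v hv)
  root_eq_zero := by simp [h.root_eq_zero, h'.root_eq_zero]

variable [Fintype V] [DecidableEq V] [DecidableRel G.Adj]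

/-- An edge inside `W` would make the form at least 6. Without such edges `U` is empty, since the
boundary edges of its faces lie inside `W`. -/
theorem PosLayer.form_eq {W : Finset V} {U : Finset M.Face} (h : M.PosLayer W U)
    (hle : M.form (-U.ind) W.ind ≤ 4) :
    U = ∅ ∧ (∀ v ∈ W, ∀ w ∈ W, ¬ G.Adj v w) ∧ M.form (-U.ind) W.ind = 2 * W.card := by
  rw [M.form_neg_ind_ind h.mem] at hle ⊢
  have hno : ∀ e, ¬ BothEnds (G := G) W e := by
    intro e he
    have := M.card_innerEdges_add_three_le h.outer h.mem ⟨e, he⟩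
    omega
  have hU : U = ∅ := by
    rw [Finset.eq_empty_iff_forall_notMem]
    intro p hp
    obtain ⟨d, rfl⟩ := M.exists_faceOf_eq p
    exact hno d.toEdge ((bothEnds_toEdge W d).2 ⟨h.mem d hp, M.snd_mem_of_faceOf_mem h.mem d hp⟩)
  refine ⟨hU, fun v hv w hw hvw => hno (Dart.toEdge ⟨(v, w), hvw⟩)
    ((bothEnds_toEdge W _).2 ⟨hv, hw⟩), ?_⟩
  have h1 : M.barEdges W U = ∅ := Finset.eq_empty_iff_forall_notMem.2 fun e he =>
    hno e (M.mem_barEdges.1 he).1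
  have h2 : M.innerEdges U = ∅ := Finset.eq_empty_iff_forall_notMem.2 fun e he =>
    hno e (M.bothEnds_of_someSide h.mem (Or.inl (M.mem_innerEdges.1 he).1))
  subst hU
  simp [h1, h2]

theorem PosLayer.two_le_form {W : Finset V} {U : Finset M.Face} (h : M.PosLayer W U)
    (hne : W.Nonempty ∨ U.Nonempty) : 2 ≤ M.form (-U.ind) W.ind := by
  by_contra! hlt
  obtain ⟨hU, -, h2⟩ := h.form_eq (by omega)
  have : W.Nonempty := hne.resolve_right (by simp [hU])
  have := this.card_pos
  omega

theorem NegLayer.subset_inside {W : Finset V} {U : Finset M.Face} (h : M.NegLayer W U) :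
    W ⊆ M.inside U := fun v hv =>
  M.mem_inside.2 ⟨h.isolated v hv, fun d hd => h.mem d (hd ▸ hv)⟩

/-- As `W ⊆ M.inside U`, the count is at least the one bounded by `card_inside_add_two_le`, and
equality passes to both comparisons. -/
theorem NegLayer.four_le_form {W : Finset V} {U : Finset M.Face} (h : M.NegLayer W U)
    (hne : W.Nonempty ∨ U.Nonempty) : 4 ≤ M.form U.ind (-W.ind) ∧
      (M.form U.ind (-W.ind) ≤ 4 → W = M.inside U ∧
        ∃ t ∈ G.cliqueFinset 3, ∀ e, M.faceBdry (M.indic U) e ≠ 0 ↔ BothEnds t e) := by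
  have hU : U.Nonempty := by
    refine hne.elim (fun ⟨v, hv⟩ => ?_) id
    obtain ⟨w, hw⟩ := exists_adj_iff_not_isIsolated.2 (h.isolated v hv)
    exact ⟨_, h.mem ⟨(v, w), hw⟩ hv⟩
  rw [M.form_ind_neg_ind h.mem]
  obtain ⟨h1, h2⟩ := M.card_inside_add_two_le h.outer hU
  have h3 := Finset.card_le_card h.subset_inside
  refine ⟨by omega, fun hle => ⟨Finset.eq_of_subset_of_card_le h.subset_inside (by omega), h2 ?_⟩⟩
  omega

/-- The total size of a state. -/
noncomputable def size (a : M.Face → ℤ) (b : V → ℤ) : ℕ := ∑ p, (a p).natAbs + ∑ v, (b v).natAbs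

theorem size_lt {a a' : M.Face → ℤ} {b b' : V → ℤ} (ha : ∀ p, (a' p).natAbs ≤ (a p).natAbs)
    (hb : ∀ v, (b' v).natAbs ≤ (b v).natAbs)
    (h : (∃ v, (b' v).natAbs < (b v).natAbs) ∨ ∃ p, (a' p).natAbs < (a p).natAbs) :
    size a' b' < size a b := by
  rcases h with ⟨v, hv⟩ | ⟨p, hp⟩
  · exact add_lt_add_of_le_of_lt (Finset.sum_le_sum fun p _ => ha p)
      (Finset.sum_lt_sum (fun v _ => hb v) ⟨v, Finset.mem_univ _, hv⟩)
  · exact add_lt_add_of_lt_of_le (Finset.sum_lt_sum (fun p _ => ha p) ⟨p, Finset.mem_univ _, hp⟩)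
      (Finset.sum_le_sum fun v _ => hb v)

/-- The set of places where a state is positive, or where it is negative, can be split off. -/
theorem Admissible.exists_layer {a : M.Face → ℤ} {b : V → ℤ} (h : M.Admissible a b)
    (hne : ¬ (a = 0 ∧ b = 0)) :
    ∃ a' b', M.Admissible a' b' ∧ size a' b' < size a b ∧
      ∃ W U, (W.Nonempty ∨ U.Nonempty) ∧
        ((M.PosLayer W U ∧ a = a' + -U.ind ∧ b = b' + W.ind) ∨
          (M.NegLayer W U ∧ a = a' + U.ind ∧ b = b' + -W.ind)) := by
  classical
  by_cases hpos : (∃ v, 1 ≤ b v) ∨ ∃ p, a p ≤ -1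
  -- All corners of a face with `a p ≤ -1` have `b ≥ 1`, so their values do not change; at any other
  -- corner with `b ≥ 1` the value is at least 1 and drops by 1.
  · set W : Finset V := Finset.univ.filter fun v => 1 ≤ b v with hW
    set U : Finset M.Face := Finset.univ.filter fun p => a p ≤ -1 with hU
    have hWi : ∀ v, (1 ≤ b v ∧ W.ind v = 1 ∧ v ∈ W) ∨ (b v ≤ 0 ∧ W.ind v = 0 ∧ v ∉ W) := by
      intro v
      by_cases hv : 1 ≤ b v
      · have : v ∈ W := by simpa [hW] using hv
        exact Or.inl ⟨hv, Finset.ind_of_mem this, this⟩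
      · have : v ∉ W := by simpa [hW] using hv
        exact Or.inr ⟨by omega, Finset.ind_of_notMem this, this⟩
    have hUi : ∀ p, (a p ≤ -1 ∧ U.ind p = 1 ∧ p ∈ U) ∨ (0 ≤ a p ∧ U.ind p = 0 ∧ p ∉ U) := by
      intro p
      by_cases hp : a p ≤ -1
      · have : p ∈ U := by simpa [hU] using hp
        exact Or.inl ⟨hp, Finset.ind_of_mem this, this⟩
      · have : p ∉ U := by simpa [hU] using hp
        exact Or.inr ⟨by omega, Finset.ind_of_notMem this, this⟩
    refine ⟨a + U.ind, b - W.ind, ⟨fun p hp => ?_, fun d => ?_, fun v hv => ?_, ?_⟩, ?_, W, U, ?_,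
      Or.inl ⟨⟨fun p hp hpU => ?_, fun hr => ?_, fun d hd => ?_⟩, by simp, by simp⟩⟩
    · have := h.outer_eq_zero p hp
      have := hUi p
      simp only [Pi.add_apply]
      omega
    · have := h.corner_nonneg d
      have := hUi (M.faceOf d)
      have := hWi d.fst
      simp only [Pi.add_apply, Pi.sub_apply]
      omega
    · have := h.isolated_nonneg v hv
      have := hWi v
      simp only [Pi.sub_apply]
      omega
    · have := h.root_eq_zero
      have := hWi M.root
      simp only [Pi.sub_apply]
      omega
    · refine size_lt (fun p => ?_) (fun v => ?_) ?_
      · have := hUi p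
        simp only [Pi.add_apply]
        omega
      · have := hWi v
        simp only [Pi.sub_apply]
        omega
      · refine hpos.imp (fun ⟨v, hv⟩ => ⟨v, ?_⟩) fun ⟨p, hp⟩ => ⟨p, ?_⟩
        · have := hWi v
          simp only [Pi.sub_apply]
          omega
        · have := hUi p
          simp only [Pi.add_apply]
          omega
    · exact hpos.imp (fun ⟨v, hv⟩ => ⟨v, by simpa [hW] using hv⟩)
        fun ⟨p, hp⟩ => ⟨p, by simpa [hU] using hp⟩
    · have := h.outer_eq_zero p hp
      have := hUi p
      simp only [hpU, not_true_eq_false, and_false, or_false] at this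
      omega
    · have := h.root_eq_zero
      have := hWi M.root
      simp only [hr, not_true_eq_false, and_false, or_false] at this
      omega
    · have h1 := h.corner_nonneg d
      have h2 := hUi (M.faceOf d)
      simp only [hd, not_true_eq_false, and_false, or_false] at h2
      rw [hW, Finset.mem_filter]
      exact ⟨Finset.mem_univ _, by omega⟩
  · have hneg : (∃ v, b v ≤ -1) ∨ ∃ p, 1 ≤ a p := by
      by_contra! hcon
      push Not at hpos
      refine hne ⟨funext fun p => ?_, funext fun v => ?_⟩
      · have := hcon.2 p
        have := hpos.2 p
        simp only [Pi.zero_apply]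
        omega
      · have := hcon.1 v
        have := hpos.1 v
        simp only [Pi.zero_apply]
        omega
    -- Here `b ≤ 0 ≤ a` everywhere, and every face at a vertex with `b ≤ -1` has `a ≥ 1`.
    set W : Finset V := Finset.univ.filter fun v => b v ≤ -1 with hW
    set U : Finset M.Face := Finset.univ.filter fun p => 1 ≤ a p with hU
    have hWi : ∀ v, (b v ≤ -1 ∧ W.ind v = 1 ∧ v ∈ W) ∨ (0 ≤ b v ∧ W.ind v = 0 ∧ v ∉ W) := by
      intro v
      by_cases hv : b v ≤ -1
      · have : v ∈ W := by simpa [hW] using hv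
        exact Or.inl ⟨hv, Finset.ind_of_mem this, this⟩
      · have : v ∉ W := by simpa [hW] using hv
        exact Or.inr ⟨by omega, Finset.ind_of_notMem this, this⟩
    have hUi : ∀ p, (1 ≤ a p ∧ U.ind p = 1 ∧ p ∈ U) ∨ (a p ≤ 0 ∧ U.ind p = 0 ∧ p ∉ U) := by
      intro p
      by_cases hp : 1 ≤ a p
      · have : p ∈ U := by simpa [hU] using hp
        exact Or.inl ⟨hp, Finset.ind_of_mem this, this⟩
      · have : p ∉ U := by simpa [hU] using hp
        exact Or.inr ⟨by omega, Finset.ind_of_notMem this, this⟩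
    refine ⟨a - U.ind, b + W.ind, ⟨fun p hp => ?_, fun d => ?_, fun v hv => ?_, ?_⟩, ?_, W, U, ?_,
      Or.inr ⟨⟨fun p hp hpU => ?_, fun v hv hiso => ?_, fun d hd => ?_⟩, by simp, by simp⟩⟩
    · have := h.outer_eq_zero p hp
      have := hUi p
      simp only [Pi.sub_apply]
      omega
    · have := h.corner_nonneg d
      have := hUi (M.faceOf d)
      have := hWi d.fst
      simp only [Pi.add_apply, Pi.sub_apply]
      omega
    · have := h.isolated_nonneg v hv
      have := hWi v
      simp only [Pi.add_apply]
      omega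
    · have := h.root_eq_zero
      have := hWi M.root
      simp only [Pi.add_apply]
      omega
    · refine size_lt (fun p => ?_) (fun v => ?_) ?_
      · have := hUi p
        simp only [Pi.sub_apply]
        omega
      · have := hWi v
        simp only [Pi.add_apply]
        omega
      · refine hneg.imp (fun ⟨v, hv⟩ => ⟨v, ?_⟩) fun ⟨p, hp⟩ => ⟨p, ?_⟩
        · have := hWi v
          simp only [Pi.add_apply]
          omega
        · have := hUi p
          simp only [Pi.sub_apply]
          omega
    · exact hneg.imp (fun ⟨v, hv⟩ => ⟨v, by simpa [hW] using hv⟩)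
        fun ⟨p, hp⟩ => ⟨p, by simpa [hU] using hp⟩
    · have := h.outer_eq_zero p hp
      have := hUi p
      simp only [hpU, not_true_eq_false, and_false, or_false] at this
      omega
    · have := h.isolated_nonneg v hiso
      have := hWi v
      simp only [hv, not_true_eq_false, and_false, or_false] at this
      omega
    · have h1 := h.corner_nonneg d
      have h2 := hWi d.fst
      simp only [hd, not_true_eq_false, and_false, or_false] at h2
      rw [hU, Finset.mem_filter]
      exact ⟨Finset.mem_univ _, by omega⟩

theorem form_zero : M.form 0 0 = 0 := by simp [form]

/-- The form `A + B` controls the size of a state. -/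
theorem Admissible.two_mul_abs_le_form {a : M.Face → ℤ} {b : V → ℤ} (h : M.Admissible a b) :
    0 ≤ M.form a b ∧ (∀ p, 2 * |a p| ≤ M.form a b) ∧ ∀ v, 2 * |b v| ≤ M.form a b := by
  -- A layer changes each entry by at most 1 and, by superadditivity, raises the form by at least 2.
  induction hn : size a b using Nat.strong_induction_on generalizing a b with
  | _ n ih =>
    by_cases hne : a = 0 ∧ b = 0
    · rw [hne.1, hne.2, form_zero]
      simp
    · obtain ⟨a', b', h', hlt, W, U, hWU, hl⟩ := h.exists_layer hne
      obtain ⟨h0, ha, hb⟩ := ih _ (hn ▸ hlt) h' rfl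
      have h1 : ∀ p, |U.ind p| ≤ 1 := fun p => by
        rcases U.ind_eq_zero_or_one p with h | h <;> simp [h]
      have h2 : ∀ v, |W.ind v| ≤ 1 := fun v => by
        rcases W.ind_eq_zero_or_one v with h | h <;> simp [h]
      rcases hl with ⟨hl, rfl, rfl⟩ | ⟨hl, rfl, rfl⟩
      · have h3 := M.form_add_le h' hl.admissible
        have h4 := hl.two_le_form hWU
        refine ⟨by omega, fun p => ?_, fun v => ?_⟩
        · have := abs_add_le (a' p) ((-U.ind) p)
          have := ha p
          have := h1 p
          rw [← abs_neg] at this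
          simp only [Pi.add_apply, Pi.neg_apply] at *
          omega
        · have := abs_add_le (b' v) (W.ind v)
          have := hb v
          have := h2 v
          simp only [Pi.add_apply] at *
          omega
      · have h3 := M.form_add_le h' hl.admissible
        have h4 := (hl.four_le_form hWU).1
        refine ⟨by omega, fun p => ?_, fun v => ?_⟩
        · have := abs_add_le (a' p) (U.ind p)
          have := ha p
          have := h1 p
          simp only [Pi.add_apply] at *
          omega
        · have := abs_add_le (b' v) ((-W.ind) v)
          have := hb v
          have := h2 v
          rw [← abs_neg] at this
          simp only [Pi.add_apply, Pi.neg_apply] at *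
          omega

/-! ### Admissible states with A + B at most 4 -/

theorem Admissible.eq_zero_of_form_le {a : M.Face → ℤ} {b : V → ℤ} (h : M.Admissible a b)
    (hle : M.form a b ≤ 0) : a = 0 ∧ b = 0 := by
  obtain ⟨-, ha, hb⟩ := h.two_mul_abs_le_form
  constructor
  · ext p
    have := ha p
    exact abs_nonpos_iff.1 (by omega)
  · ext v
    have := hb v
    exact abs_nonpos_iff.1 (by omega)

theorem Admissible.eq_of_form_eq_two {a : M.Face → ℤ} {b : V → ℤ} (h : M.Admissible a b)
    (hQ : M.form a b = 2) : ∃ v ≠ M.root, a = 0 ∧ b = Finset.ind {v} := by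
  obtain ⟨a', b', h', -, W, U, hWU, hl⟩ := h.exists_layer (by
    rintro ⟨rfl, rfl⟩
    rw [form_zero] at hQ
    omega)
  have h0 := h'.two_mul_abs_le_form.1
  rcases hl with ⟨hl, rfl, rfl⟩ | ⟨hl, rfl, rfl⟩
  · have h3 := M.form_add_le h' hl.admissible
    have h4 := hl.two_le_form hWU
    obtain ⟨rfl, rfl⟩ := h'.eq_zero_of_form_le (by omega)
    obtain ⟨rfl, -, h5⟩ := hl.form_eq (by omega)
    obtain ⟨v, rfl⟩ := Finset.card_eq_one.1 (show W.card = 1 by omega)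
    refine ⟨v, fun hv => hl.root (by simp [hv]), by simp, by simp⟩
  · have h3 := M.form_add_le h' hl.admissible
    have h4 := (hl.four_le_form hWU).1
    omega

theorem form_zero_of_not_adj {b : V → ℤ} (h : ∀ d : G.Dart, b d.fst * b d.snd = 0) :
    M.form 0 b = 2 * ∑ v, b v := by
  rw [form_zero_left, Finset.sum_eq_zero fun d _ => h d, zero_add]

theorem form_ind_singleton (v : V) : M.form 0 (Finset.ind {v}) = 2 := by
  rw [form_zero_of_not_adj, Finset.sum_ind]
  · simp
  · intro d
    by_cases h : d.fst = v
    · rw [Finset.ind_of_notMem (x := d.snd), mul_zero]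
      simp [← h]
    · rw [Finset.ind_of_notMem (x := d.fst), zero_mul]
      simpa using h

theorem form_ind_add_ind {v w : V} (h : ¬ G.Adj v w) :
    M.form 0 (Finset.ind {v} + Finset.ind {w}) = 4 := by
  rw [form_zero_of_not_adj]
  · simp [Finset.sum_add_distrib, Finset.sum_ind]
  · intro d
    have hd : G.Adj d.fst d.snd := d.adj
    by_contra hne
    rw [mul_eq_zero, not_or] at hne
    have key : ∀ z, (Finset.ind {v} + Finset.ind {w}) z ≠ 0 → z = v ∨ z = w := by
      intro z hz
      by_contra! hcon
      refine hz ?_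
      rw [Pi.add_apply, Finset.ind_of_notMem (by simpa using hcon.1),
        Finset.ind_of_notMem (by simpa using hcon.2), add_zero]
    rcases key _ hne.1 with h1 | h1 <;> rcases key _ hne.2 with h2 | h2 <;> rw [h1, h2] at hd
    · exact hd.ne rfl
    · exact h hd
    · exact h hd.symm
    · exact hd.ne rfl

theorem four_lt_form_ind_add_ind {v w : V} (h : G.Adj v w) :
    4 < M.form 0 (Finset.ind {v} + Finset.ind {w}) := by
  have hnn : ∀ z, 0 ≤ (Finset.ind {v} + Finset.ind {w} : V → ℤ) z := fun z => by
    have := Finset.ind_eq_zero_or_one {v} z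
    have := Finset.ind_eq_zero_or_one {w} z
    simp only [Pi.add_apply]
    omega
  have h1 : 0 < ∑ d : G.Dart, (Finset.ind {v} + Finset.ind {w} : V → ℤ) d.fst *
      (Finset.ind {v} + Finset.ind {w} : V → ℤ) d.snd := by
    refine Finset.sum_pos' (fun d _ => mul_nonneg (hnn _) (hnn _))
      ⟨⟨(v, w), h⟩, Finset.mem_univ _, ?_⟩
    have hne := h.ne
    simp [Finset.ind, hne, hne.symm]
  rw [form_zero_left]
  simp only [Pi.add_apply, Finset.sum_add_distrib, Finset.sum_ind, Finset.card_singleton] at h1 ⊢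
  omega

theorem Admissible.eq_of_form_eq_four {a : M.Face → ℤ} {b : V → ℤ} (h : M.Admissible a b)
    (hQ : M.form a b = 4) :
    (∃ v w, v ≠ M.root ∧ w ≠ M.root ∧ ¬ G.Adj v w ∧ a = 0 ∧ b = Finset.ind {v} + Finset.ind {w}) ∨
    ∃ U : Finset M.Face, (∀ p ∈ M.outer, p ∉ U) ∧ a = U.ind ∧ b = -(M.inside U).ind ∧
      ∃ t ∈ G.cliqueFinset 3, ∀ e, M.faceBdry (M.indic U) e ≠ 0 ↔ BothEnds t e := by
  obtain ⟨a', b', h', -, W, U, hWU, hl⟩ := h.exists_layer (by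
    rintro ⟨rfl, rfl⟩
    rw [form_zero] at hQ
    omega)
  have h0 := h'.two_mul_abs_le_form.1
  rcases hl with ⟨hl, rfl, rfl⟩ | ⟨hl, rfl, rfl⟩
  · left
    have h3 := M.form_add_le h' hl.admissible
    have h4 := hl.two_le_form hWU
    obtain ⟨rfl, hadj, h5⟩ := hl.form_eq (by omega)
    -- Either the layer uses up the whole form and `W` is an independent pair, or layer and
    -- remainder are single vertices, possibly the same one.
    by_cases h6 : M.form a' b' ≤ 0
    · obtain ⟨rfl, rfl⟩ := h'.eq_zero_of_form_le h6
      simp only [zero_add] at hQ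
      obtain ⟨v, w, hvw, rfl⟩ := Finset.card_eq_two.1 (show W.card = 2 by omega)
      refine ⟨v, w, fun hv => hl.root (by simp [hv]), fun hv => hl.root (by simp [hv]),
        hadj v (by simp) w (by simp), by simp, ?_⟩
      ext x
      by_cases h1 : x = v
      · subst h1; simp [Finset.ind, hvw]
      · simp [Finset.ind, h1]
    · obtain ⟨k, hk⟩ := M.even_form a' b'
      obtain ⟨v, hv, rfl, rfl⟩ := h'.eq_of_form_eq_two (by omega)
      obtain ⟨w, rfl⟩ := Finset.card_eq_one.1 (show W.card = 1 by omega)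
      refine ⟨v, w, hv, fun hw => hl.root (by simp [hw]), fun hvw => ?_, by simp, rfl⟩
      have := four_lt_form_ind_add_ind (M := M) hvw
      simp only [Finset.ind_empty, neg_zero, add_zero] at hQ
      omega
  · right
    have h3 := M.form_add_le h' hl.admissible
    have h4 := hl.four_le_form hWU
    obtain ⟨rfl, rfl⟩ := h'.eq_zero_of_form_le (by omega)
    obtain ⟨rfl, ht⟩ := h4.2 (by omega)
    exact ⟨U, hl.outer, by simp, by simp, ht⟩

theorem inside_negLayer {U : Finset M.Face} (hU : ∀ p ∈ M.outer, p ∉ U) :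
    M.NegLayer (M.inside U) U where
  outer := hU
  isolated _ hv := (M.mem_inside.1 hv).1
  mem := M.faceOf_mem_of_mem_inside

variable (M) in
/-- Every triangle gives a state of weight 2. -/
theorem exists_state_of_clique {t : Finset V} (ht : t ∈ G.cliqueFinset 3) :
    ∃ U : Finset M.Face, (∀ p ∈ M.outer, p ∉ U) ∧
      (∀ e, M.faceBdry (M.indic U) e ≠ 0 ↔ BothEnds t e) ∧ U.Nonempty ∧
      M.form U.ind (-(M.inside U).ind) = 4 := by
  obtain ⟨U, hU, hbd, hle, hch, hne⟩ := M.exists_faces_of_clique ht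
  refine ⟨U, hU, hbd, hne, ?_⟩
  have h1 := (M.card_inside_add_two_le hU hne).1
  rw [M.form_ind_neg_ind M.faceOf_mem_of_mem_inside, hch, Finset.card_empty]
  omega

open scoped Classical in
-- Modulo 2 only the sum of `a` over the darts survives in `B`; an edge contributes 1 to it exactly
-- when it lies on the boundary of `U`, and there are three such edges.
theorem odd_B_of_clique {t : Finset V} (ht : t ∈ G.cliqueFinset 3) {U : Finset M.Face}
    (hU : ∀ p ∈ M.outer, p ∉ U)
    (hbd : ∀ e, M.faceBdry (M.indic U) e ≠ 0 ↔ BothEnds t e) (b : V → ℤ) :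
    Odd (M.B U.ind b) := by
  obtain ⟨hc3, hχ, hχ0⟩ := card_bothEnds_le_three ht
  have h3 : (Finset.univ.filter fun e : G.edgeSet => BothEnds t e).card = 3 :=
    le_antisymm hc3 (three_le_card_of_bdry_eq_zero hχ hχ0 fun e he => by simpa using he)
  rw [← Int.not_even_iff_odd, ← ZMod.intCast_eq_zero_iff_even,
    M.B_eq (fun p hp => Finset.ind_of_notMem (hU p hp)), sum_dart_eq_sum_edge]
  have h2 : (2 : ZMod 2) = 0 := by decide
  push_cast
  rw [h2, zero_mul, zero_mul, zero_add, sub_zero]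
  have : ∀ e : G.edgeSet, ((U.ind (M.faceOf (edgeDart e)) : ℤ) : ZMod 2) +
      ((U.ind (M.faceOf (edgeDart e).symm) : ℤ) : ZMod 2) = if BothEnds t e then 1 else 0 := by
    intro e
    have h1 : M.faceBdry (M.indic U) e = ((U.ind (M.faceOf (edgeDart e)) : ℤ) : ZMod 2) +
      ((U.ind (M.faceOf (edgeDart e).symm) : ℤ) : ZMod 2) := by
      change M.indic U _ + M.indic U _ = _
      simp [indic, Finset.ind]
    rw [← h1]
    by_cases he : BothEnds t e
    · rw [if_pos he, ZMod.eq_one_of_ne_zero_mod_two ((hbd e).2 he)]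
    · rw [if_neg he]
      exact not_not.1 (mt (hbd e).1 he)
  rw [Finset.sum_congr rfl fun e _ => this e, Finset.sum_boole, h3]
  decide

end RootedPlaneGraph

/-! ### Low order coefficients -/

section Coefficients

theorem PowerSeries.coeff_one_mul' {R : Type*} [CommSemiring R] (f g : R⟦X⟧) :
    coeff 1 (f * g) = coeff 0 f * coeff 1 g + coeff 1 f * coeff 0 g := by
  rw [coeff_mul, Finset.Nat.antidiagonal_succ]
  simp

theorem PowerSeries.coeff_two_mul' {R : Type*} [CommSemiring R] (f g : R⟦X⟧) :
    coeff 2 (f * g) = coeff 0 f * coeff 2 g + coeff 1 f * coeff 1 g + coeff 2 f * coeff 0 g := by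
  rw [coeff_mul, Finset.Nat.sum_antidiagonal_eq_sum_range_succ_mk]
  simp [Finset.sum_range_succ]

open PowerSeries

theorem PowerSeries.coeff_one_prod {R ι : Type*} [CommSemiring R] (s : Finset ι) (f : ι → R⟦X⟧)
    (hf : ∀ i ∈ s, coeff 0 (f i) = 1) :
    coeff 0 (∏ i ∈ s, f i) = 1 ∧ coeff 1 (∏ i ∈ s, f i) = ∑ i ∈ s, coeff 1 (f i) := by
  classical
  induction s using Finset.induction_on with
  | empty => simp [coeff_one]
  | insert i s hi ih =>
    obtain ⟨h0, h1⟩ := ih fun j hj => hf j (Finset.mem_insert_of_mem hj)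
    rw [Finset.prod_insert hi, Finset.sum_insert hi]
    have := hf i (Finset.mem_insert_self _ _)
    constructor
    · rw [coeff_zero_eq_constantCoeff] at *
      rw [map_mul, this, h0, one_mul]
    · rw [coeff_one_mul', this, h0, h1, one_mul, mul_one, add_comm]

/-- The product (1 - q)(1 - q²) is 1 - q - q² + q³, and later factors do not affect the coefficients
up to q². -/
theorem coeff_qFactorial_two_add (n : ℕ) :
    coeff 0 (qFactorial (n + 2)) = 1 ∧ coeff 1 (qFactorial (n + 2)) = -1 ∧
      coeff 2 (qFactorial (n + 2)) = -1 := by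
  induction n with
  | zero =>
    have h : qFactorial (0 + 2) = (1 - X ^ 1) * (1 - X ^ 2) := by
      simp [qFactorial, Finset.prod_range_succ]
    rw [h, coeff_one_mul', coeff_two_mul', coeff_zero_eq_constantCoeff]
    simp [coeff_one, coeff_X_pow, coeff_X]
  | succ n ih =>
    have h : qFactorial (n + 1 + 2) = qFactorial (n + 2) - qFactorial (n + 2) * X ^ (n + 3) := by
      rw [qFactorial, Finset.prod_range_succ, ← qFactorial, mul_sub, mul_one]
    rw [h]
    simp only [map_sub, coeff_mul_X_pow']
    rw [if_neg (by omega), if_neg (by omega), if_neg (by omega)]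
    simpa using ih

theorem coeff_qFactorialInf {k : ℕ} {c : ℤ} (h : ∀ n, coeff k (qFactorial (n + 2)) = c) :
    coeff k qFactorialInf = c := by
  have h1 := (hasProd_qFactorialInf.tendsto_prod_nat).comp (Filter.tendsto_add_atTop_nat 2)
  have h2 := ((WithPiTopology.continuous_coeff ℤ k).tendsto _).comp h1
  exact tendsto_nhds_unique h2 (tendsto_const_nhds.congr fun n => (h n).symm)

theorem coeff_qFactorialInf_pow (n : ℕ) :
    coeff 0 (qFactorialInf ^ n) = 1 ∧ coeff 1 (qFactorialInf ^ n) = -n ∧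
      2 * coeff 2 (qFactorialInf ^ n) = (n : ℤ) ^ 2 - 3 * n := by
  have e0 := coeff_qFactorialInf fun n => (coeff_qFactorial_two_add n).1
  have e1 := coeff_qFactorialInf fun n => (coeff_qFactorial_two_add n).2.1
  have e2 := coeff_qFactorialInf fun n => (coeff_qFactorial_two_add n).2.2
  induction n with
  | zero => simp [coeff_one]
  | succ n ih =>
    obtain ⟨h0, h1, h2⟩ := ih
    rw [pow_succ, coeff_one_mul', coeff_two_mul', e0, e1, e2, h0, h1]
    refine ⟨?_, by push_cast; ring, ?_⟩
    · rw [coeff_zero_eq_constantCoeff] at *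
      rw [map_mul, h0, e0, one_mul]
    · push_cast
      linear_combination h2

theorem coeff_zero_qFactorialInv (n : ℕ) : coeff 0 (qFactorialInv n) = 1 := by
  have := congrArg (coeff 0) (qFactorial_mul_qFactorialInv n)
  rw [coeff_zero_eq_constantCoeff] at *
  simpa [constantCoeff_qFactorial] using this

theorem qFactorialInv_zero : qFactorialInv 0 = 1 := by
  have := qFactorial_mul_qFactorialInv 0
  simpa [qFactorial] using this

theorem coeff_one_qFactorialInv_one : coeff 1 (qFactorialInv 1) = 1 := by
  have := congrArg (coeff 1) (qFactorial_mul_qFactorialInv 1)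
  rw [coeff_one_mul', coeff_zero_qFactorialInv] at this
  simp [qFactorial, coeff_one, coeff_X] at this
  linarith

end Coefficients

/-! ### Exponents and convergence -/

namespace RootedPlaneGraph

open SimpleGraph PowerSeries

variable {V : Type*} {G : SimpleGraph V} {M : RootedPlaneGraph G}
variable [Fintype V] [DecidableEq V] [DecidableRel G.Adj]

/-- The exponent `(A + B) / 2` of a state. -/
noncomputable def weight (s : M.State) : ℕ := ((M.A s.1.1 s.1.2 + M.B s.1.1 s.1.2) / 2).toNat

theorem Admissible.exists_A_add_B {a : M.Face → ℤ} {b : V → ℤ} (h : M.Admissible a b) :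
    ∃ n : ℕ, M.A a b + M.B a b = 2 * (n : ℤ) := by
  rw [M.A_add_B_eq h.outer_eq_zero]
  obtain ⟨k, hk⟩ := M.even_form a b
  have := h.two_mul_abs_le_form.1
  exact ⟨k.toNat, by omega⟩

theorem form_eq_two_mul_weight (s : M.State) : M.form s.1.1 s.1.2 = 2 * weight s := by
  obtain ⟨n, hn⟩ := s.2.exists_A_add_B
  rw [weight, hn, ← M.A_add_B_eq s.2.outer_eq_zero, hn]
  omega

theorem coeff_term (s : M.State) (k : ℕ) :
    coeff k (M.term s) = if weight s ≤ k then ((Int.negOnePow (M.B s.1.1 s.1.2) : ℤˣ) : ℤ) *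
      coeff (k - weight s)
        (∏ d : G.Dart, qFactorialInv (s.1.1 (M.faceOf d) + s.1.2 d.fst).toNat) else 0 := by
  rw [term, mul_assoc, coeff_C_mul, ← weight, coeff_X_pow_mul']
  split_ifs <;> simp

theorem coeff_weight_term (s : M.State) {k : ℕ} (h : weight s = k) :
    coeff k (M.term s) = ((Int.negOnePow (M.B s.1.1 s.1.2) : ℤˣ) : ℤ) := by
  rw [coeff_term, if_pos h.le, h, Nat.sub_self,
    (coeff_one_prod _ _ fun d _ => coeff_zero_qFactorialInv _).1, mul_one]

theorem coeff_term_of_lt (s : M.State) {k : ℕ} (h : k < weight s) : coeff k (M.term s) = 0 := by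
  rw [coeff_term, if_neg (by omega)]

theorem finite_weight_le (n : ℕ) : {s : M.State | weight s ≤ n}.Finite := by
  have h1 : {x : (M.Face → ℤ) × (V → ℤ) | (∀ p, x.1 p ∈ Set.Icc (-n : ℤ) n) ∧
      ∀ v, x.2 v ∈ Set.Icc (-n : ℤ) n}.Finite := by
    have := (Set.Finite.pi' fun _ : M.Face => Set.finite_Icc (-n : ℤ) n).prod
      (Set.Finite.pi' fun _ : V => Set.finite_Icc (-n : ℤ) n)
    exact this.subset fun x hx => hx
  refine (h1.preimage Subtype.val_injective.injOn).subset fun s hs => ?_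
  obtain ⟨-, ha, hb⟩ := s.2.two_mul_abs_le_form
  have hw := form_eq_two_mul_weight s
  replace hs : weight (M := M) s ≤ n := hs
  refine ⟨fun p => ?_, fun v => ?_⟩
  · exact abs_le.1 (by have := ha p; omega)
  · exact abs_le.1 (by have := hb v; omega)

theorem summable_term : Summable M.term := by
  rw [WithPiTopology.summable_iff_summable_coeff]
  refine fun k => summable_of_hasFiniteSupport ((finite_weight_le k).subset fun s hs => ?_)
  by_contra h
  exact hs (coeff_term_of_lt s (not_le.1 h))

theorem coeff_tsum_term (k : ℕ) : coeff k (∑' s, M.term s) = ∑' s, coeff k (M.term s) :=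
  ((WithPiTopology.hasSum_iff_hasSum_coeff ℤ).1 summable_term.hasSum k).tsum_eq.symm

/-! ### The states of weight at most two -/

/-- The sum of the indicator functions of the two members of an unordered pair. -/
noncomputable def pairInd : Sym2 V → V → ℤ :=
  Sym2.lift ⟨fun v w => Finset.ind {v} + Finset.ind {w}, fun _ _ => add_comm _ _⟩

theorem ind_singleton_injective : Function.Injective fun v : V => Finset.ind {v} := by
  intro v w h
  have := congrFun h v
  simp only [Finset.ind_of_mem (Finset.mem_singleton_self v)] at this
  by_contra hne
  rw [Finset.ind_of_notMem (by simpa using hne)] at this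
  omega

theorem pairInd_injective : Function.Injective (pairInd (V := V)) := by
  intro z z' h
  induction z using Sym2.ind with
  | _ v w =>
  induction z' using Sym2.ind with
  | _ x y =>
  change Finset.ind {v} + Finset.ind {w} = Finset.ind {x} + Finset.ind {y} at h
  have h1 : v = x ∨ v = y := by
    by_contra! hne
    have := congrFun h v
    simp only [Pi.add_apply, Finset.ind_of_mem (Finset.mem_singleton_self v)] at this
    rw [Finset.ind_of_notMem (S := {x}) (by simpa using hne.1),
      Finset.ind_of_notMem (S := {y}) (by simpa using hne.2)] at this
    have := Finset.ind_eq_zero_or_one {w} v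
    omega
  rcases h1 with rfl | rfl
  · rw [ind_singleton_injective (add_left_cancel h)]
  · rw [add_comm (Finset.ind {x})] at h
    rw [ind_singleton_injective (add_left_cancel h), Sym2.eq_swap]

variable (M)

/-- The unordered pairs of vertices, possibly equal, that are not adjacent and avoid the root. -/
noncomputable def farPairs : Finset (Sym2 V) :=
  (Finset.univ.erase M.root).sym2 \ G.edgeFinset

variable {M}

theorem mk_mem_farPairs {v w : V} :
    s(v, w) ∈ M.farPairs ↔ (v ≠ M.root ∧ w ≠ M.root) ∧ ¬ G.Adj v w := by
  simp [farPairs]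

theorem admissible_ind {v : V} (h : v ≠ M.root) : M.Admissible 0 (Finset.ind {v}) := by
  simpa using (PosLayer.singleton h).admissible

theorem admissible_pairInd {z : Sym2 V} (hz : z ∈ M.farPairs) :
    M.Admissible 0 (pairInd z) ∧ M.form 0 (pairInd z) = 4 := by
  induction z using Sym2.ind with
  | _ v w =>
  obtain ⟨⟨hv, hw⟩, h⟩ := mk_mem_farPairs.1 hz
  refine ⟨?_, form_ind_add_ind h⟩
  have := (admissible_ind hv).add (admissible_ind hw)
  rwa [add_zero] at this

/-- The n - 1 vertices other than the root have n(n-1)/2 unordered pairs with repetition; only edges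
avoiding the root are removed, whence the degree of the root. -/
theorem card_farPairs : 2 * (M.farPairs.card : ℤ) =
    (Fintype.card V : ℤ) * (Fintype.card V - 1) - 2 * G.edgeFinset.card + 2 * G.degree M.root := by
  have h1 : G.edgeFinset ∩ (Finset.univ.erase M.root).sym2 =
      G.edgeFinset \ G.incidenceFinset M.root := by
    ext z
    induction z using Sym2.ind with
    | _ v w =>
    simp only [Finset.mem_inter, Finset.mem_sdiff, mem_edgeFinset, mem_edgeSet,
      Finset.mk_mem_sym2_iff, Finset.mem_erase, Finset.mem_univ, and_true, mem_incidenceFinset,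
      incidenceSet, Set.mem_sep_iff, Sym2.mem_iff, not_and, not_or]
    constructor
    · exact fun h => ⟨h.1, fun _ => ⟨fun h' => h.2.1 h'.symm, fun h' => h.2.2 h'.symm⟩⟩
    · exact fun h => ⟨h.1, fun h' => (h.2 h.1).1 h'.symm, fun h' => (h.2 h.1).2 h'.symm⟩
  have h2 := Finset.card_sdiff_add_card_inter (Finset.univ.erase M.root).sym2 G.edgeFinset
  rw [Finset.inter_comm, h1, Finset.card_sym2, Finset.card_erase_of_mem (Finset.mem_univ _),
    Finset.card_univ] at h2
  have h3 := Finset.card_sdiff_add_card_eq_card (G.incidenceFinset_subset M.root)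
  rw [card_incidenceFinset_eq_degree] at h3
  have h4 : 0 < Fintype.card V := Fintype.card_pos_iff.2 ⟨M.root⟩
  obtain ⟨m, hm⟩ : ∃ m, Fintype.card V = m + 1 := ⟨_, (Nat.succ_pred_eq_of_pos h4).symm⟩
  rw [hm, Nat.add_sub_cancel] at h2
  have h5 : 2 * (m + 1).choose 2 = (m + 1) * m := by
    rw [Nat.choose_two_right, Nat.add_sub_cancel,
      Nat.mul_div_cancel' (by rw [mul_comm]; exact (Nat.even_mul_succ_self m).two_dvd)]
  change M.farPairs.card + _ = _ at h2
  rw [hm]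
  push_cast
  have h2' : (M.farPairs.card : ℤ) + (G.edgeFinset \ G.incidenceFinset M.root).card =
    (m + 1).choose 2 := by exact_mod_cast h2
  have h3' : ((G.edgeFinset \ G.incidenceFinset M.root).card : ℤ) + G.degree M.root =
    G.edgeFinset.card := by exact_mod_cast h3
  have h5' : 2 * ((m + 1).choose 2 : ℤ) = (m + 1) * m := by exact_mod_cast h5
  linear_combination 2 * h2' - 2 * h3' + h5'

variable (M)

/-- The bounded faces inside a triangle. -/
noncomputable def triangleFaces (t : {t // t ∈ G.cliqueFinset 3}) : Finset M.Face :=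
  (M.exists_state_of_clique t.2).choose

theorem triangleFaces_spec (t : {t // t ∈ G.cliqueFinset 3}) :
    (∀ p ∈ M.outer, p ∉ M.triangleFaces t) ∧
      (∀ e, M.faceBdry (M.indic (M.triangleFaces t)) e ≠ 0 ↔ BothEnds t.1 e) ∧
      (M.triangleFaces t).Nonempty ∧
      M.form (M.triangleFaces t).ind (-(M.inside (M.triangleFaces t)).ind) = 4 :=
  (M.exists_state_of_clique t.2).choose_spec

/-- The states of weight at most two. -/
noncomputable def lowState :
    Unit ⊕ {v // v ≠ M.root} ⊕ {z // z ∈ M.farPairs} ⊕ {t // t ∈ G.cliqueFinset 3} → M.State :=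
  Sum.elim (fun _ => ⟨(0, 0), admissible_zero⟩) <|
    Sum.elim (fun v => ⟨(0, Finset.ind {v.1}), admissible_ind v.2⟩) <|
      Sum.elim (fun z => ⟨(0, pairInd z.1), (admissible_pairInd z.2).1⟩)
        fun t => ⟨((M.triangleFaces t).ind, -(M.inside (M.triangleFaces t)).ind),
          (inside_negLayer (M.triangleFaces_spec t).1).admissible⟩

variable {M}

theorem weight_lowState_inl (u : Unit) : weight (M.lowState (.inl u)) = 0 := by
  have := form_eq_two_mul_weight (M.lowState (.inl u))
  change M.form 0 0 = _ at this
  rw [form_zero] at this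
  omega

theorem weight_lowState_ind (v : {v // v ≠ M.root}) :
    weight (M.lowState (.inr (.inl v))) = 1 := by
  have := form_eq_two_mul_weight (M.lowState (.inr (.inl v)))
  change M.form 0 (Finset.ind {v.1}) = _ at this
  rw [form_ind_singleton] at this
  omega

theorem weight_lowState_pairInd (z : {z // z ∈ M.farPairs}) :
    weight (M.lowState (.inr (.inr (.inl z)))) = 2 := by
  have := form_eq_two_mul_weight (M.lowState (.inr (.inr (.inl z))))
  change M.form 0 (pairInd z.1) = _ at this
  rw [(admissible_pairInd z.2).2] at this
  omega

theorem weight_lowState_triangle (t : {t // t ∈ G.cliqueFinset 3}) :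
    weight (M.lowState (.inr (.inr (.inr t)))) = 2 := by
  have := form_eq_two_mul_weight (M.lowState (.inr (.inr (.inr t))))
  change M.form (M.triangleFaces t).ind (-(M.inside (M.triangleFaces t)).ind) = _ at this
  rw [(M.triangleFaces_spec t).2.2.2] at this
  omega

theorem _root_.Finset.ind_injective {α : Type*} : Function.Injective (Finset.ind (α := α)) := by
  intro S T h
  ext x
  have := congrFun h x
  by_cases h1 : x ∈ S <;> by_cases h2 : x ∈ T <;>
    simp_all [Finset.ind_of_mem, Finset.ind_of_notMem]

theorem eq_of_bothEnds_iff {t t' : Finset V} (ht : t ∈ G.cliqueFinset 3)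
    (ht' : t' ∈ G.cliqueFinset 3) (h : ∀ e : G.edgeSet, BothEnds t e ↔ BothEnds t' e) :
    t = t' := by
  rw [mem_cliqueFinset_iff] at ht ht'
  refine Finset.eq_of_subset_of_card_le (fun v hv => ?_) (by rw [ht.card_eq, ht'.card_eq])
  obtain ⟨w, hw, hwv⟩ := Finset.exists_mem_ne (by rw [ht.card_eq]; omega) v
  have hadj : G.Adj v w := ht.isClique hv hw hwv.symm
  exact ((bothEnds_toEdge t' _).1 ((h (Dart.toEdge ⟨(v, w), hadj⟩)).1
    ((bothEnds_toEdge t _).2 ⟨hv, hw⟩))).1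

theorem lowState_injective : Function.Injective M.lowState := by
  refine Function.Injective.sumElim (fun _ _ _ => rfl)
    (Function.Injective.sumElim (fun v w h => ?_)
      (Function.Injective.sumElim (fun z z' h => ?_) (fun t t' h => ?_) fun z t h => ?_)
      fun v x h => ?_) fun u x h => ?_
  · exact Subtype.ext (ind_singleton_injective (congrArg (fun s : M.State => s.1.2) h))
  · exact Subtype.ext (pairInd_injective (congrArg (fun s : M.State => s.1.2) h))
  · have h1 : M.triangleFaces t = M.triangleFaces t' :=
      Finset.ind_injective (congrArg (fun s : M.State => s.1.1) h)
    have h2 := (M.triangleFaces_spec t).2.1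
    rw [h1] at h2
    exact Subtype.ext (eq_of_bothEnds_iff t.2 t'.2 fun e =>
      (h2 e).symm.trans ((M.triangleFaces_spec t').2.1 e))
  · have h1 : (∅ : Finset M.Face).ind = (M.triangleFaces t).ind := by
      rw [Finset.ind_empty]
      exact congrArg (fun s : M.State => s.1.1) h
    exact (M.triangleFaces_spec t).2.2.1.ne_empty (Finset.ind_injective h1).symm
  · have h1 := congrArg weight h
    have h2 := weight_lowState_ind v
    rcases x with z | t
    · have h3 := weight_lowState_pairInd (M := M) z
      exact absurd (h2.symm.trans (h1.trans h3)) (by omega)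
    · have h3 := weight_lowState_triangle (M := M) t
      exact absurd (h2.symm.trans (h1.trans h3)) (by omega)
  · have h1 := congrArg weight h
    have h2 := weight_lowState_inl (M := M) u
    rcases x with v | z | t
    · exact absurd (h2.symm.trans (h1.trans (weight_lowState_ind v))) (by omega)
    · exact absurd (h2.symm.trans (h1.trans (weight_lowState_pairInd z))) (by omega)
    · exact absurd (h2.symm.trans (h1.trans (weight_lowState_triangle t))) (by omega)

theorem exists_lowState_eq {s : M.State} (h : weight s ≤ 2) : ∃ i, M.lowState i = s := by
  have hw := form_eq_two_mul_weight s
  obtain ⟨⟨a, b⟩, hs⟩ := s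
  change M.Admissible a b at hs
  change M.form a b = _ at hw
  have h3 : M.form a b = 0 ∨ M.form a b = 2 ∨ M.form a b = 4 := by omega
  rcases h3 with h3 | h3 | h3
  · obtain ⟨rfl, rfl⟩ := hs.eq_zero_of_form_le h3.le
    exact ⟨.inl (), rfl⟩
  · obtain ⟨v, hv, rfl, rfl⟩ := hs.eq_of_form_eq_two h3
    exact ⟨.inr (.inl ⟨v, hv⟩), rfl⟩
  · rcases hs.eq_of_form_eq_four h3 with
      ⟨v, w, hv, hw', hvw, rfl, rfl⟩ | ⟨U, hU, rfl, rfl, t, ht, hbd⟩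
    · exact ⟨.inr (.inr (.inl ⟨s(v, w), mk_mem_farPairs.2 ⟨⟨hv, hw'⟩, hvw⟩⟩)), rfl⟩
    · have : M.triangleFaces ⟨t, ht⟩ = U := by
        obtain ⟨hout, hbd', -, -⟩ := M.triangleFaces_spec ⟨t, ht⟩
        -- A set of bounded faces is determined by its boundary.
        have h4 : M.indic (M.triangleFaces ⟨t, ht⟩) - M.indic U = 0 := by
          refine M.eq_zero_of_faceBdry_eq_zero (fun p hp => ?_) ?_
          · simp [indic, hout p hp, hU p hp]
          · rw [map_sub, sub_eq_zero]
            ext e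
            by_cases he : BothEnds t e
            · rw [ZMod.eq_one_of_ne_zero_mod_two ((hbd e).2 he),
                ZMod.eq_one_of_ne_zero_mod_two ((hbd' e).2 he)]
            · rw [not_not.1 (mt (hbd e).1 he), not_not.1 (mt (hbd' e).1 he)]
        ext p
        have h5 := congrFun h4 p
        by_cases h6 : p ∈ M.triangleFaces ⟨t, ht⟩ <;> by_cases h7 : p ∈ U <;>
          simp_all [indic]
      subst this
      exact ⟨.inr (.inr (.inr ⟨t, ht⟩)), rfl⟩

theorem coeff_tsum_term_eq_sum {k : ℕ} (hk : k ≤ 2) :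
    coeff k (∑' s, M.term s) = ∑ i, coeff k (M.term (M.lowState i)) := by
  rw [coeff_tsum_term, ← tsum_fintype (L := .unconditional _),
    lowState_injective.tsum_eq (f := fun s => coeff k (M.term s))]
  intro s hs
  refine exists_lowState_eq ?_
  by_contra h
  exact hs (coeff_term_of_lt s (by omega))

/-! ### Coefficients of the sum over states -/

theorem negOnePow_B_pos {b : V → ℤ} : ((Int.negOnePow (M.B 0 b) : ℤˣ) : ℤ) = 1 := by
  rw [Int.negOnePow_even, Units.val_one]
  rw [M.B_eq (a := 0) (fun _ _ => rfl)]
  simp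

theorem term_lowState_inl (u : Unit) : M.term (M.lowState (.inl u)) = 1 := by
  have hw := weight_lowState_inl (M := M) u
  rw [term, ← weight, hw]
  change C ((Int.negOnePow (M.B 0 0) : ℤˣ) : ℤ) * X ^ 0 *
    ∏ d : G.Dart, qFactorialInv (0 + 0 : ℤ).toNat = 1
  rw [negOnePow_B_pos]
  simp [qFactorialInv_zero]

/-- Each corner at `v` contributes a factor 1/(q)_1 = 1 + q + ⋯ to a term that starts at q. -/
theorem coeff_two_term_lowState_ind (v : {v // v ≠ M.root}) :
    coeff 2 (M.term (M.lowState (.inr (.inl v)))) = G.degree v.1 := by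
  rw [coeff_term, weight_lowState_ind, if_pos (by omega)]
  change ((Int.negOnePow (M.B 0 (Finset.ind {v.1})) : ℤˣ) : ℤ) * coeff 1
    (∏ d : G.Dart, qFactorialInv (0 + Finset.ind {v.1} d.fst).toNat) = _
  rw [negOnePow_B_pos, one_mul, (coeff_one_prod _ _ fun d _ => coeff_zero_qFactorialInv _).2,
    ← dart_fst_fiber_card_eq_degree, Finset.card_filter, Nat.cast_sum]
  refine Finset.sum_congr rfl fun d _ => ?_
  by_cases h : d.fst = v
  · simp [Finset.ind, h, coeff_one_qFactorialInv_one]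
  · simp [Finset.ind, h, qFactorialInv_zero, coeff_one]

theorem coeff_two_term_lowState_triangle (t : {t // t ∈ G.cliqueFinset 3}) :
    coeff 2 (M.term (M.lowState (.inr (.inr (.inr t))))) = -1 := by
  rw [coeff_weight_term _ (weight_lowState_triangle t)]
  change ((Int.negOnePow (M.B (M.triangleFaces t).ind _) : ℤˣ) : ℤ) = _
  obtain ⟨h1, h2, -⟩ := M.triangleFaces_spec t
  rw [Int.negOnePow_odd _ (odd_B_of_clique t.2 h1 h2 _)]
  simp

theorem coeff_zero_tsum_term : coeff 0 (∑' s, M.term s) = 1 := by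
  rw [coeff_tsum_term_eq_sum (by omega)]
  simp only [Fintype.sum_sum_type, term_lowState_inl]
  rw [Finset.sum_eq_zero fun v _ => coeff_term_of_lt _ (by rw [weight_lowState_ind]; omega),
    Finset.sum_eq_zero fun z _ => coeff_term_of_lt _ (by rw [weight_lowState_pairInd]; omega),
    Finset.sum_eq_zero fun t _ => coeff_term_of_lt _ (by rw [weight_lowState_triangle]; omega)]
  simp

theorem coeff_one_tsum_term : coeff 1 (∑' s, M.term s) = (Fintype.card V : ℤ) - 1 := by
  rw [coeff_tsum_term_eq_sum (by omega)]
  simp only [Fintype.sum_sum_type, term_lowState_inl]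
  have h1 : ∀ v : {v // v ≠ M.root}, coeff 1 (M.term (M.lowState (.inr (.inl v)))) = 1 :=
    fun v => by
      rw [coeff_weight_term _ (weight_lowState_ind v)]
      exact negOnePow_B_pos
  rw [Finset.sum_congr rfl fun v _ => h1 v,
    Finset.sum_eq_zero fun z _ => coeff_term_of_lt _ (by rw [weight_lowState_pairInd]; omega),
    Finset.sum_eq_zero fun t _ => coeff_term_of_lt _ (by rw [weight_lowState_triangle]; omega)]
  have h4 : 0 < Fintype.card V := Fintype.card_pos_iff.2 ⟨M.root⟩
  have h5 : Fintype.card {v // v ≠ M.root} = Fintype.card V - 1 := by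
    simp [Fintype.card_subtype_compl]
  simp only [Finset.sum_const, Finset.card_univ, h5, coeff_one]
  simp
  omega

/-- The degree sum omits the root, and the count of pairs contains the degree of the root, so the
choice of root cancels. Doubling keeps the identity in `ℤ`. -/
theorem coeff_two_tsum_term : 2 * coeff 2 (∑' s, M.term s) =
    2 * (G.edgeFinset.card : ℤ) + (Fintype.card V : ℤ) * (Fintype.card V - 1) -
      2 * (G.cliqueFinset 3).card := by
  rw [coeff_tsum_term_eq_sum (by omega)]
  simp only [Fintype.sum_sum_type, term_lowState_inl, coeff_two_term_lowState_ind,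
    coeff_two_term_lowState_triangle]
  have h1 : ∀ z : {z // z ∈ M.farPairs},
      coeff 2 (M.term (M.lowState (.inr (.inr (.inl z))))) = 1 := fun z => by
    rw [coeff_weight_term _ (weight_lowState_pairInd z)]
    exact negOnePow_B_pos
  rw [Finset.sum_congr rfl fun z _ => h1 z]
  have h2 : ∑ v : {v // v ≠ M.root}, (G.degree v.1 : ℤ) + G.degree M.root =
      2 * G.edgeFinset.card := by
    have h3 := G.sum_degrees_eq_twice_card_edges
    rw [← Finset.sum_erase_add _ _ (Finset.mem_univ M.root)] at h3
    have h4 : ∑ v : {v // v ≠ M.root}, (G.degree v.1 : ℤ) =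
        ∑ v ∈ Finset.univ.erase M.root, (G.degree v : ℤ) :=
      (Finset.sum_subtype _ (by simp) fun v => (G.degree v : ℤ)).symm
    rw [h4]
    exact_mod_cast h3
  have h3 := card_farPairs (M := M)
  have h4 : Fintype.card {t // t ∈ G.cliqueFinset 3} = (G.cliqueFinset 3).card :=
    Fintype.card_coe _
  have h5 : Fintype.card {z // z ∈ M.farPairs} = M.farPairs.card := Fintype.card_coe _
  simp only [Finset.sum_const, Finset.card_univ, h4, h5, coeff_one, nsmul_eq_mul]
  simp
  linear_combination 2 * h2 + h3

end RootedPlaneGraph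

/-- The first two conjuncts say that the series `Φ_G(q)` is well defined: every state contributes
at a natural power of `q`, and the sum over the states converges. -/
theorem theorem1p3 {V : Type*} [Fintype V] [DecidableEq V] (G : SimpleGraph V)
    [DecidableRel G.Adj] (M : RootedPlaneGraph G) :
    (∀ (a : M.Face → ℤ) (b : V → ℤ), M.Admissible a b →
        ∃ n : ℕ, M.A a b + M.B a b = 2 * (n : ℤ)) ∧
      Summable M.term ∧
      PowerSeries.coeff 0 M.Phi = 1 ∧
      PowerSeries.coeff 1 M.Phi = (Fintype.card V : ℤ) - (G.edgeFinset.card : ℤ) - 1 ∧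
      ((PowerSeries.coeff 2 M.Phi : ℤ) : ℚ) =
        1 / 2 * (((Fintype.card V : ℚ) - (G.edgeFinset.card : ℚ)) ^ 2
          - 2 * ((G.cliqueFinset 3).card : ℚ)
          - (Fintype.card V : ℚ) + (G.edgeFinset.card : ℚ)) := by
  obtain ⟨q0, q1, q2⟩ := coeff_qFactorialInf_pow G.edgeFinset.card
  have s0 := RootedPlaneGraph.coeff_zero_tsum_term (M := M)
  have s1 := RootedPlaneGraph.coeff_one_tsum_term (M := M)
  have s2 := RootedPlaneGraph.coeff_two_tsum_term (M := M)
  refine ⟨fun a b h => h.exists_A_add_B, RootedPlaneGraph.summable_term, ?_, ?_, ?_⟩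
  · rw [RootedPlaneGraph.Phi]
    rw [PowerSeries.coeff_zero_eq_constantCoeff] at *
    rw [map_mul, q0, s0, one_mul]
  · rw [RootedPlaneGraph.Phi, PowerSeries.coeff_one_mul', q0, q1, s0, s1]
    ring
  · have h : 2 * PowerSeries.coeff 2 M.Phi =
        ((Fintype.card V : ℤ) - G.edgeFinset.card) ^ 2 - 2 * (G.cliqueFinset 3).card -
          Fintype.card V + G.edgeFinset.card := by
      rw [RootedPlaneGraph.Phi, PowerSeries.coeff_two_mul', q0, q1, s0, s1]
      linear_combination q2 + s2
    have h' := congrArg (Int.cast : ℤ → ℚ) h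
    push_cast at h'
    linear_combination h' / 2
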